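/- **Theorem (stability of the constant system).** Let $n\ge 0$, $A\in\mathbb H^{n\times n}$ and $t_0\in\mathbb R$, and consider the system $\dot x=Ax$ on $[t_0,\infty)$ with $x(t)\in\mathbb H^n$. Put $\|\eta\|=\sum_k|\eta_k|$ for $\eta\in\mathbb H^n$ and regard $\mathbb C=\{a+b\,\mathbf i\}\subset\mathbb H$. A solution $\varphi$ on $[t_0,\infty)$ is *stable* if for every $\varepsilon>0$ there is $\delta>0$ such that for every $x\in\mathbb H^n$ with $\|x-\varphi(t_0)\|<\delta$, the solution $\psi$ with $\psi(t_0)=x$ exists on $[t_0,\infty)$ and satisfies $\|\psi(t)-\varphi(t)\|<\varepsilon$ for all $t\ge t_0$. It is *asymptotically stable* if there is $\delta>0$ such that for every $x$ with $\|x-\varphi(t_0)\|<\delta$, the solution $\psi$ with $\psi(t_0)=x$ exists on $[t_0,\infty)$ and $\|\psi(t)-\varphi(t)\|\to0$ as $t\to\infty$. The system is (asymptotically) stable if all its solutions are. A *standard eigenvalue* of $A$ is a complex number $\lambda$ with $\operatorname{Im}\lambda\ge0$ such that $A\eta=\eta\lambda$ for some nonzero $\eta\in\mathbb H^n$. A *Jordan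 canonical form of $A$ in $\mathbb C^{n\times n}$* is a complex matrix $J$ that is block diagonal with upper triangular Jordan blocks, whose diagonal entries have nonnegative imaginary parts, and such that $P^{-1}AP=J$ for some invertible $P\in\mathbb H^{n\times n}$. The *algebraic multiplicity* of a standard eigenvalue $\lambda$ is the number of its occurrences on the diagonal of $J$; its *geometric multiplicity* is $\dim_{\mathbb C}\{x\in\mathbb C^n:(J-\lambda I)x=0\}$. Then $A$ has a Jordan canonical form $J$ in $\mathbb C^{n\times n}$, and, whichever such $J$ is used to define the multiplicities: 1. the system $\dot x=Ax$ is stable if and only if all standard eigenvalues of $A$ have nonpositive real part and, for each standard eigenvalue with zero real part, the algebraic multiplicity equals the geometric multiplicity; 2. the system $\dot x=Ax$ is asymptotically stable if and only if all standard eigenvalues of $A$ have negative real part. -/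

import Mathlib

namespace QuaternionODE

/-- The norm `∑ₖ |ηₖ|` on `ℍⁿ`. -/
noncomputable def vecNorm {n : ℕ} (x : Fin n → Quaternion ℝ) : ℝ := ∑ k, ‖x k‖

/-- `φ` solves `x' = f(t, x)` on `[t₀, ∞)` (with the one-sided derivative at `t₀`). -/
def IsSolution {n : ℕ} (f : ℝ → (Fin n → Quaternion ℝ) → (Fin n → Quaternion ℝ)) (t₀ : ℝ)
    (φ : ℝ → Fin n → Quaternion ℝ) : Prop :=
  ∀ t ∈ Set.Ici t₀, HasDerivWithinAt φ (f t (φ t)) (Set.Ici t₀) t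

/-- The solution `φ` is stable in the sense of Lyapunov: for every `ε > 0` there is `δ > 0` such
that the solution from any initial value within `δ` of `φ t₀` exists on `[t₀, ∞)` and stays
within `ε` of `φ`. -/
def IsStableSolution {n : ℕ} (f : ℝ → (Fin n → Quaternion ℝ) → (Fin n → Quaternion ℝ)) (t₀ : ℝ)
    (φ : ℝ → Fin n → Quaternion ℝ) : Prop :=
  ∀ ε > 0, ∃ δ > 0, ∀ x : Fin n → Quaternion ℝ, vecNorm (x - φ t₀) < δ →
    (∃ ψ, IsSolution f t₀ ψ ∧ ψ t₀ = x) ∧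
    ∀ ψ, IsSolution f t₀ ψ → ψ t₀ = x → ∀ t ≥ t₀, vecNorm (ψ t - φ t) < ε

/-- The solution `φ` is asymptotically stable: there is `δ > 0` such that the solution from any
initial value within `δ` of `φ t₀` exists on `[t₀, ∞)` and its distance to `φ` tends to `0`. -/
def IsAsymptoticallyStableSolution {n : ℕ}
    (f : ℝ → (Fin n → Quaternion ℝ) → (Fin n → Quaternion ℝ)) (t₀ : ℝ)
    (φ : ℝ → Fin n → Quaternion ℝ) : Prop :=
  ∃ δ > 0, ∀ x : Fin n → Quaternion ℝ, vecNorm (x - φ t₀) < δ →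
    (∃ ψ, IsSolution f t₀ ψ ∧ ψ t₀ = x) ∧
    ∀ ψ, IsSolution f t₀ ψ → ψ t₀ = x →
      Filter.Tendsto (fun t => vecNorm (ψ t - φ t)) Filter.atTop (nhds 0)

/-- The right-hand side of the constant system `x' = A x`. -/
def constantField {n : ℕ} (A : Matrix (Fin n) (Fin n) (Quaternion ℝ)) :
    ℝ → (Fin n → Quaternion ℝ) → (Fin n → Quaternion ℝ) :=
  fun _ x => A.mulVec x

/-- The system `x' = A x` on `[t₀, ∞)` is stable: all its solutions are stable. -/
def IsStableSystem {n : ℕ} (A : Matrix (Fin n) (Fin n) (Quaternion ℝ)) (t₀ : ℝ) : Prop :=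
  ∀ φ, IsSolution (constantField A) t₀ φ → IsStableSolution (constantField A) t₀ φ

/-- The system `x' = A x` on `[t₀, ∞)` is asymptotically stable: all its solutions are. -/
def IsAsymptoticallyStableSystem {n : ℕ} (A : Matrix (Fin n) (Fin n) (Quaternion ℝ))
    (t₀ : ℝ) : Prop :=
  ∀ φ, IsSolution (constantField A) t₀ φ → IsAsymptoticallyStableSolution (constantField A) t₀ φ

/-- `q` is a right eigenvalue of `A`: `A η = η q` for some `η ≠ 0`. -/
def IsRightEigenvalue {n : ℕ} (A : Matrix (Fin n) (Fin n) (Quaternion ℝ))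
    (q : Quaternion ℝ) : Prop :=
  ∃ η : Fin n → Quaternion ℝ, η ≠ 0 ∧ A.mulVec η = fun i => η i * q

/-- The standard eigenvalues: the complex right eigenvalues with nonnegative imaginary part
(`ℂ` sits in `ℍ` as `a + b i`). -/
def IsStandardEigenvalue {n : ℕ} (A : Matrix (Fin n) (Fin n) (Quaternion ℝ)) (z : ℂ) : Prop :=
  0 ≤ z.im ∧ IsRightEigenvalue A (Quaternion.coeComplex z)

/-- `J` is block diagonal with (upper) Jordan blocks: off the diagonal and the superdiagonal it
vanishes, and a superdiagonal entry is `0`, or is `1` between two equal diagonal entries. -/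
def IsJordanMatrix {n : ℕ} (J : Matrix (Fin n) (Fin n) ℂ) : Prop :=
  (∀ i j : Fin n, (j : ℕ) ≠ i → (j : ℕ) ≠ i + 1 → J i j = 0) ∧
  (∀ i j : Fin n, (j : ℕ) = i + 1 → J i j = 0 ∨ (J i j = 1 ∧ J i i = J j j))

/-- `J` is a Jordan canonical form of the quaternion matrix `A` in `ℂⁿˣⁿ`: a complex Jordan matrix
whose diagonal entries have nonnegative imaginary parts, with `P⁻¹ A P = J` for some invertible
quaternion matrix `P`. -/
def IsJordanFormOf {n : ℕ} (J : Matrix (Fin n) (Fin n) ℂ)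
    (A : Matrix (Fin n) (Fin n) (Quaternion ℝ)) : Prop :=
  IsJordanMatrix J ∧ (∀ i, 0 ≤ (J i i).im) ∧
  ∃ P : (Matrix (Fin n) (Fin n) (Quaternion ℝ))ˣ,
    ((P⁻¹ : (Matrix (Fin n) (Fin n) (Quaternion ℝ))ˣ) : Matrix (Fin n) (Fin n) (Quaternion ℝ))
      * A * (P : Matrix (Fin n) (Fin n) (Quaternion ℝ)) = J.map Quaternion.coeComplex

/-- Algebraic multiplicity read off from a Jordan form `J`: the number of occurrences of `z` on
the diagonal of `J`. -/
noncomputable def algebraicMultiplicity {n : ℕ} (J : Matrix (Fin n) (Fin n) ℂ) (z : ℂ) : ℕ :=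
  Nat.card {i : Fin n // J i i = z}

/-- Geometric multiplicity read off from a Jordan form `J`: the complex dimension of
`{x ∈ ℂⁿ : (J - z I) x = 0}`. -/
noncomputable def geometricMultiplicity {n : ℕ} (J : Matrix (Fin n) (Fin n) ℂ) (z : ℂ) : ℕ :=
  Module.finrank ℂ (LinearMap.ker (Matrix.mulVecLin (J - z • (1 : Matrix (Fin n) (Fin n) ℂ))))

end QuaternionODE

/-!
Both stability notions are properties of the homogeneous linear flow. By linearity, scaling and
the uniform boundedness principle, the system is stable if and only if each of its solutions is
bounded (`isStableSystem_iff`), and asymptotically stable if and only if each of its solutions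
tends to `0` (`isAsymptoticallyStableSystem_iff`).

Columns of quaternions form a right vector space over `ℍ`, that is, a module over `ℍᵐᵒᵖ`, on which
`A` acts linearly. The Jordan form comes from a basis of Jordan chains (`hasJordanChainBasis`).
Right multiplication by a nonreal `λ` is not linear over `ℍ`, so one works with the real quadratic
polynomial `S = (A - a)² + b²`, where `λ = a + b i`. Fitting's decomposition for `S` and induction
on the dimension reduce to nilpotent `S`. If `b = 0`, then `A - a` is nilpotent, and nilpotent maps
have chain bases over every division ring (`IsNilpotent.exists_chain_basis`). If `b > 0`, the space
is over `ℂ` the sum of the generalized eigenspaces of `λ` and of its conjugate, which are exchanged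
by right multiplication by `j`; hence a complex chain basis of the first is a quaternionic basis of
the whole space.

Let now `P⁻¹ A P = J` be a Jordan form. The standard eigenvalues of `A` are the diagonal entries of
`J` (`isStandardEigenvalue_iff`), and the two multiplicities of `z` agree if and only if all blocks
of `J` for `z` have size one (`IsJordanMatrix.algebraicMultiplicity_eq_iff`). In the coordinates
`y = P⁻¹ x` the system consists of the equations `yᵢ' = Jᵢᵢ yᵢ + ε yᵢ₊₁` with `ε ∈ {0, 1}`. By
variation of constants, the coordinates in the blocks with `Re z < 0` decay exponentially, and those
in blocks of size one with `Re z = 0` have constant norm. Conversely, an eigenvector `η` gives the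
solution `η e^{z t}`, and a block of size at least two contains a chain `w, u` that gives the
solution `(u + t w) e^{z t}`, which is unbounded for `Re z = 0`.
-/

open Module MulOpposite Quaternion

/-! ### Chain bases of nilpotent maps over a division ring -/

/-- A nilpotent endomorphism of a finite-dimensional vector space over a division ring has a basis
made of chains `v c 0, …, v c (len c - 1)`, each vector being mapped to its predecessor and the
first one to `0`. By induction on the dimension: prolong a chain basis of the range by one preimage
at the end of each chain, and complete the initial vectors to a basis of the kernel. -/
theorem IsNilpotent.exists_chain_basis {D : Type*} [DivisionRing D] {V : Type*} [AddCommGroup V]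
    [Module D V] [FiniteDimensional D V] (N : V →ₗ[D] V) (hN : IsNilpotent N) :
    ∃ (C : Type) (_ : Fintype C) (len : C → ℕ) (v : C → ℕ → V),
      LinearIndependent D (fun s : Σ c, Fin (len c) => v s.1 s.2) ∧
      Submodule.span D (Set.range fun s : Σ c, Fin (len c) => v s.1 s.2) = ⊤ ∧
      (∀ c, 0 < len c) ∧ (∀ c, N (v c 0) = 0) ∧
      (∀ c k, k + 1 < len c → N (v c (k + 1)) = v c k) := by
  induction hd : finrank D V using Nat.strong_induction_on generalizing V with
  | _ d ih =>
  subst hd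
  rcases subsingleton_or_nontrivial V with hV | hV
  · exact ⟨Empty, inferInstance, fun c => c.elim, fun c => c.elim, linearIndependent_empty_type,
      Subsingleton.elim _ _, fun c => c.elim, fun c => c.elim, fun c => c.elim⟩
  have hmaps : ∀ x ∈ LinearMap.range N, N x ∈ LinearMap.range N := fun x _ => ⟨x, rfl⟩
  have hlt : finrank D (LinearMap.range N) < finrank D V := by
    refine Submodule.finrank_lt fun htop => ?_
    have hsurj : Function.Surjective N := LinearMap.range_eq_top.1 htop
    obtain ⟨m, hm⟩ := hN
    have : Function.Surjective (N ^ m) := by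
      rw [Module.End.coe_pow]; exact hsurj.iterate m
    obtain ⟨x, hx⟩ := exists_ne (0 : V)
    obtain ⟨y, hy⟩ := this x
    exact hx (by rw [← hy, hm]; rfl)
  have hnil : IsNilpotent (N.restrict hmaps) := Module.End.isNilpotent.restrict hmaps hN
  obtain ⟨C, _, len, w, hli, hsp, hpos, hw0, hws⟩ := ih _ hlt (N.restrict hmaps) hnil rfl
  -- the initial vectors of the chains are linearly independent in the kernel
  let g : C → LinearMap.ker N := fun c => ⟨w c 0, by
    have := congrArg Subtype.val (hw0 c)
    simpa using this⟩
  have hg : LinearIndependent D g := by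
    have h1 : LinearIndependent D (fun c => (w c 0)) :=
      hli.comp (fun c => (⟨c, ⟨0, hpos c⟩⟩ : Σ c, Fin (len c))) fun a b h => by
        simpa using congrArg Sigma.fst h
    have h2 := h1.map' (LinearMap.range N).subtype (Submodule.ker_subtype _)
    exact LinearIndependent.of_comp (LinearMap.ker N).subtype h2
  let B : Basis (C ⊕ Basis.sumExtendIndex hg) D (LinearMap.ker N) := Basis.sumExtend hg
  have hfin : Finite (C ⊕ Basis.sumExtendIndex hg) := Module.Finite.finite_basis B
  have hfin' : Finite (Basis.sumExtendIndex hg) := 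
    Finite.of_injective (Sum.inr : _ → C ⊕ Basis.sumExtendIndex hg) Sum.inr_injective
  let e := Finite.equivFin (Basis.sumExtendIndex hg)
  set r := Nat.card (Basis.sumExtendIndex hg)
  -- `u c` prolongs the chain `c`
  choose u hu using fun c => (w c (len c - 1)).2
  let len' : C ⊕ Fin r → ℕ := Sum.elim (fun c => len c + 1) (fun _ => 1)
  let v : C ⊕ Fin r → ℕ → V := Sum.elim
    (fun c k => if k < len c then (w c k : V) else u c) (fun j _ => (B (Sum.inr (e.symm j)) : V))
  have hvs : ∀ c k, k < len c → N (v (Sum.inl c) (k + 1)) = w c k := by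
    intro c k hk
    by_cases h : k + 1 < len c
    · have := congrArg Subtype.val (hws c k h)
      simpa [v, h] using this
    · have : k = len c - 1 := by omega
      subst this
      simp only [v, Sum.elim_inl, if_neg h, hu]
  have hv0 : ∀ c, v (Sum.inl c) 0 = w c 0 := fun c => by simp [v, hpos c]
  have hspan : Submodule.span D (Set.range fun s : Σ c, Fin (len' c) => v s.1 s.2) = ⊤ := by
    set S := Submodule.span D (Set.range fun s : Σ c, Fin (len' c) => v s.1 s.2)
    have hmem : ∀ c k, k < len' c → v c k ∈ S := fun c k hk =>
      Submodule.subset_span ⟨⟨c, ⟨k, hk⟩⟩, rfl⟩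
    have hker : LinearMap.ker N ≤ S := by
      have h1 : LinearMap.ker N =
          (Submodule.span D (Set.range B)).map (LinearMap.ker N).subtype := by
        rw [B.span_eq, Submodule.map_top, Submodule.range_subtype]
      rw [h1, Submodule.map_span_le]
      rintro _ ⟨s | s, rfl⟩
      · have h2 : B (Sum.inl s) = g s := by
          simp only [B, Basis.sumExtend, Basis.reindex_apply, Basis.extend_apply_self]
          rfl
        rw [h2]
        have := hmem (Sum.inl s) 0 (by simp [len'])
        rwa [hv0] at this
      · have := hmem (Sum.inr (e s)) 0 (by simp [len'])
        simpa [v] using this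
    have hrange : LinearMap.range N ≤ S.map N := by
      have h1 : LinearMap.range N = (Submodule.span D (Set.range
          fun s : Σ c, Fin (len c) => w s.1 s.2)).map (LinearMap.range N).subtype := by
        rw [hsp, Submodule.map_top, Submodule.range_subtype]
      conv_lhs => rw [h1]
      rw [Submodule.map_span_le]
      rintro _ ⟨⟨c, k⟩, rfl⟩
      exact ⟨v (Sum.inl c) (k + 1), hmem _ _ (by simp [len']), hvs c k k.2⟩
    rw [eq_top_iff]
    intro x _
    obtain ⟨y, hy, hyx⟩ := hrange ⟨x, rfl⟩
    have : x - y ∈ S := hker (by simp [hyx])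
    simpa using S.add_mem this hy
  refine ⟨C ⊕ Fin r, inferInstance, len', v, ?_, hspan, ?_, ?_, ?_⟩
  · refine linearIndependent_of_top_le_span_of_card_eq_finrank hspan.ge ?_
    have h1 : ∑ c, len c = finrank D (LinearMap.range N) := by
      rw [← (finrank_eq_card_basis (Basis.mk hli hsp.ge)).symm]; simp
    have h2 : Fintype.card C + r = finrank D (LinearMap.ker N) := by
      rw [finrank_eq_nat_card_basis B, Nat.card_sum, Nat.card_eq_fintype_card]
    rw [← N.finrank_range_add_finrank_ker, ← h1, ← h2]
    simp [len', Finset.sum_add_distrib, add_assoc]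
  · rintro (c | j) <;> simp [len']
  · rintro (c | j)
    · rw [hv0]; exact (g c).2
    · exact (B (Sum.inr (e.symm j))).2
  · rintro (c | j) k hk
    · have hk' : k < len c := by simpa [len'] using hk
      rw [hvs c k hk']
      simp [v, hk']
    · simp [len'] at hk

/-! ### Jordan chains in right quaternionic spaces -/

namespace QuaternionODE

section RightQuaternionSpaces

variable {V : Type*} [AddCommGroup V] [Module ℍ[ℝ]ᵐᵒᵖ V]

/-- A right quaternionic space as a complex one, through `a + b i ∈ ℂ ⊂ ℍ`. It is not an instance,
since a space may carry another complex structure. -/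
noncomputable abbrev rightComplexModule (V : Type*) [AddCommGroup V] [Module ℍ[ℝ]ᵐᵒᵖ V] :
    Module ℂ V :=
  Module.compHom V ((Quaternion.ofComplex : ℂ →+* ℍ[ℝ]).toOpposite fun z w => by
    rw [Commute, SemiconjBy, ← map_mul, ← map_mul, mul_comm])

/-- The quaternion unit `j`. -/
def quatJ : ℍ[ℝ] := ⟨0, 0, 1, 0⟩

@[simp] theorem re_quatJ : quatJ.re = 0 := rfl

@[simp] theorem imI_quatJ : quatJ.imI = 0 := rfl

@[simp] theorem imJ_quatJ : quatJ.imJ = 1 := rfl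

@[simp] theorem imK_quatJ : quatJ.imK = 0 := rfl

theorem quatJ_mul_quatJ : quatJ * quatJ = -1 := by
  ext <;> simp

theorem coeComplex_mul_quatJ (z : ℂ) :
    coeComplex z * quatJ = quatJ * coeComplex ((starRingEnd ℂ) z) := by
  ext <;> simp

theorem eq_coeComplex_add_mul_quatJ (q : ℍ[ℝ]) :
    q = coeComplex ⟨q.re, q.imI⟩ + coeComplex ⟨q.imJ, q.imK⟩ * quatJ := by
  ext <;> simp

/-- `x (z + w j) = x z + (x w) j` for complex `z` and `w`. -/
theorem op_smul_eq (q : ℍ[ℝ]) (x : V) :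
    op q • x = op (coeComplex ⟨q.re, q.imI⟩) • x +
      op quatJ • op (coeComplex ⟨q.imJ, q.imK⟩) • x := by
  conv_lhs => rw [eq_coeComplex_add_mul_quatJ q]
  rw [op_add, add_smul, op_mul, mul_smul]

theorem quatJ_smul_quatJ_smul (x : V) : op quatJ • op quatJ • x = -x := by
  rw [smul_smul, ← op_mul, quatJ_mul_quatJ, op_neg, op_one, neg_smul, one_smul]

/-- If the vectors `b i` form a quaternionic basis, then the vectors `b i` and `(b i) j` span the
space over `ℂ`. -/
theorem finiteDimensional_complex [FiniteDimensional ℍ[ℝ]ᵐᵒᵖ V] :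
    letI := rightComplexModule V
    FiniteDimensional ℂ V := by
  let := rightComplexModule V
  let b := Module.finBasis ℍ[ℝ]ᵐᵒᵖ V
  refine ⟨Submodule.fg_def.2 ⟨Set.range b ∪ Set.range fun i => op quatJ • b i,
    (Set.finite_range _).union (Set.finite_range _), ?_⟩⟩
  rw [eq_top_iff]
  intro x _
  rw [← b.sum_repr x]
  refine Submodule.sum_mem _ fun i _ => ?_
  rw [← op_unop (b.repr x i), op_smul_eq]
  refine Submodule.add_mem _ ?_ ?_
  · exact Submodule.smul_mem _ (_ : ℂ) (Submodule.subset_span (Or.inl ⟨i, rfl⟩))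
  · set w : ℂ := ⟨(unop (b.repr x i)).imJ, (unop (b.repr x i)).imK⟩
    rw [smul_smul, ← op_mul, coeComplex_mul_quatJ, op_mul, mul_smul]
    exact Submodule.smul_mem _ ((starRingEnd ℂ) w) (Submodule.subset_span (Or.inr ⟨i, rfl⟩))

/-- Multiplication by a real number, which is linear because the reals are central in `ℍ`. -/
noncomputable def realScale (V : Type*) [AddCommGroup V] [Module ℍ[ℝ]ᵐᵒᵖ V] (a : ℝ) :
    Module.End ℍ[ℝ]ᵐᵒᵖ V where
  toFun x := op (a : ℍ[ℝ]) • x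
  map_add' := smul_add _
  map_smul' d x := by
    rw [RingHom.id_apply, smul_smul, smul_smul]
    congr 1
    apply unop_injective
    simpa using (Quaternion.coe_commutes a (unop d)).symm

theorem realScale_apply (a : ℝ) (x : V) : realScale V a x = op (a : ℍ[ℝ]) • x := rfl

theorem commute_realScale (T : Module.End ℍ[ℝ]ᵐᵒᵖ V) (a : ℝ) : Commute T (realScale V a) := by
  ext x; simp [realScale_apply]

/-- The value at `T` of the real quadratic polynomial `(X - a)² + b²` with roots `a ± b i`. -/
noncomputable def quadraticEnd (T : Module.End ℍ[ℝ]ᵐᵒᵖ V) (a b : ℝ) : Module.End ℍ[ℝ]ᵐᵒᵖ V :=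
  (T - realScale V a) ^ 2 + realScale V (b ^ 2)

theorem commute_quadraticEnd (T : Module.End ℍ[ℝ]ᵐᵒᵖ V) (a b : ℝ) :
    Commute T (quadraticEnd T a b) :=
  (((Commute.refl T).sub_right (commute_realScale T a)).pow_right 2).add_right
    (commute_realScale T _)

/-- The space has a basis of Jordan chains of `T`: the chain `c` consists of the vectors
`v c 0, …, v c (len c - 1)` and belongs to the right eigenvalue `lam c`, a complex number with
nonnegative imaginary part. -/
def HasJordanChainBasis (T : Module.End ℍ[ℝ]ᵐᵒᵖ V) : Prop :=
  ∃ (C : Type) (_ : Fintype C) (len : C → ℕ) (lam : C → ℂ) (v : C → ℕ → V),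
    LinearIndependent ℍ[ℝ]ᵐᵒᵖ (fun s : Σ c, Fin (len c) => v s.1 s.2) ∧
    Submodule.span ℍ[ℝ]ᵐᵒᵖ (Set.range fun s : Σ c, Fin (len c) => v s.1 s.2) = ⊤ ∧
    (∀ c, 0 ≤ (lam c).im) ∧
    (∀ c, T (v c 0) = op (coeComplex (lam c)) • v c 0) ∧
    (∀ c k, k + 1 < len c →
      T (v c (k + 1)) = op (coeComplex (lam c)) • v c (k + 1) + v c k)

theorem hasJordanChainBasis_of_isNilpotent_sub [FiniteDimensional ℍ[ℝ]ᵐᵒᵖ V]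
    (T : Module.End ℍ[ℝ]ᵐᵒᵖ V) (a : ℝ) (h : IsNilpotent (T - realScale V a)) :
    HasJordanChainBasis T := by
  obtain ⟨C, _, len, v, hli, hsp, -, h0, hs⟩ := h.exists_chain_basis
  refine ⟨C, inferInstance, len, fun _ => a, v, hli, hsp, fun c => by simp, fun c => ?_,
    fun c k hk => ?_⟩
  · have := h0 c
    rw [LinearMap.sub_apply, sub_eq_zero, realScale_apply] at this
    rw [this, coeComplex_coe]
  · have := hs c k hk
    rw [LinearMap.sub_apply, sub_eq_iff_eq_add', realScale_apply] at this
    rw [this, coeComplex_coe]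

/-- A right linear map as a complex linear map. -/
noncomputable def toComplexEnd (T : Module.End ℍ[ℝ]ᵐᵒᵖ V) :
    letI := rightComplexModule V
    Module.End ℂ V :=
  letI := rightComplexModule V
  { toFun := T
    map_add' := T.map_add
    map_smul' := fun z x => T.map_smul (op (coeComplex z)) x }

/-- If `(T - a)² + b²` is nilpotent and `b > 0`, then the space is, over `ℂ`, the sum of the
generalized eigenspaces `E` and `E'` of `a + b i` and `a - b i`, and multiplication by `j`
exchanges the two. Hence a complex chain basis of `E` is a quaternionic basis of the space. -/
theorem hasJordanChainBasis_of_isNilpotent_quadraticEnd [FiniteDimensional ℍ[ℝ]ᵐᵒᵖ V]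
    (T : Module.End ℍ[ℝ]ᵐᵒᵖ V) (a b : ℝ) (hb : 0 < b) (h : IsNilpotent (quadraticEnd T a b)) :
    HasJordanChainBasis T := by
  let := rightComplexModule V
  have : FiniteDimensional ℂ V := finiteDimensional_complex
  have hsmul : ∀ (z : ℂ) (x : V), z • x = op (coeComplex z) • x := fun _ _ => rfl
  let Tc : Module.End ℂ V := toComplexEnd T
  let μ : ℂ := ⟨a, b⟩
  let ν : ℂ := (starRingEnd ℂ) μ
  have hμν : μ ≠ ν := fun h => by
    have := congrArg Complex.im h
    simp only [μ, ν, Complex.conj_im] at this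
    linarith
  obtain ⟨m, hm⟩ := h
  let p : Polynomial ℂ := (Polynomial.X - Polynomial.C μ) ^ m
  let q : Polynomial ℂ := (Polynomial.X - Polynomial.C ν) ^ m
  have hpq : IsCoprime p q :=
    (Polynomial.isCoprime_X_sub_C_of_isUnit_sub (sub_ne_zero.2 hμν).isUnit).pow
  let N₁ : Module.End ℂ V := Tc - algebraMap ℂ _ μ
  let N₂ : Module.End ℂ V := Tc - algebraMap ℂ _ ν
  have hN₁ : ∀ x, N₁ x = T x - op (coeComplex μ) • x := fun _ => rfl
  have hN₂ : ∀ x, N₂ x = T x - op (coeComplex ν) • x := fun _ => rfl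
  have hp : Polynomial.aeval Tc p = N₁ ^ m := by simp [p, N₁]
  have hq : Polynomial.aeval Tc q = N₂ ^ m := by simp [q, N₂]
  -- `N₁ N₂ = (T - a)² + b²`, since `μ ν = a² + b²` and `μ + ν = 2 a`
  have hN : ∀ x, (N₁ * N₂) x = quadraticEnd T a b x := by
    intro x
    have e1 : (μ * ν) • x =
        op (a : ℍ[ℝ]) • op (a : ℍ[ℝ]) • x + op (b : ℍ[ℝ]) • op (b : ℍ[ℝ]) • x := by
      rw [← coeComplex_coe, ← coeComplex_coe, ← hsmul, ← hsmul, ← hsmul, ← hsmul, smul_smul,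
        smul_smul, ← add_smul]
      congr 1
      apply Complex.ext <;> simp [μ, ν]
      ring
    have e2 : μ • T x + ν • T x = op (a : ℍ[ℝ]) • T x + op (a : ℍ[ℝ]) • T x := by
      rw [← coeComplex_coe, ← hsmul, ← add_smul, ← add_smul]
      congr 1
      apply Complex.ext <;> simp [μ, ν]
    have e3 : op ((b ^ 2 : ℝ) : ℍ[ℝ]) • x = op (b : ℍ[ℝ]) • op (b : ℍ[ℝ]) • x := by
      rw [smul_smul, ← op_mul, ← Quaternion.coe_mul, pow_two]
    have e4 : op (coeComplex μ) • op (coeComplex ν) • x = (μ * ν) • x := by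
      rw [← hsmul, ← hsmul, smul_smul]
    rw [hsmul, hsmul] at e2
    simp only [Module.End.mul_apply, hN₁, hN₂, quadraticEnd, pow_two (T - _), LinearMap.add_apply,
      LinearMap.sub_apply, realScale_apply, map_sub, smul_sub, map_smul, e3, e4, e1]
    rw [eq_sub_of_add_eq e2]
    abel
  have hcomm : Commute N₁ N₂ :=
    ((Commute.refl Tc).sub_left (Algebra.commute_algebraMap_left μ Tc)).sub_right
      ((Algebra.commute_algebraMap_right ν Tc).sub_left (Algebra.commute_algebraMap_left μ _))
  have hprod : Polynomial.aeval Tc (p * q) = 0 := by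
    rw [map_mul, hp, hq, ← hcomm.mul_pow]
    ext x
    have h1 : (⇑(N₁ * N₂)) = quadraticEnd T a b := funext hN
    rw [Module.End.pow_apply, h1, ← Module.End.pow_apply, hm]
    rfl
  set E := LinearMap.ker (Polynomial.aeval Tc p) with hE
  set E' := LinearMap.ker (Polynomial.aeval Tc q) with hE'
  have hdisj : Disjoint E E' := Polynomial.disjoint_ker_aeval_of_isCoprime Tc hpq
  have hsup : E ⊔ E' = ⊤ := by
    rw [hE, hE', Polynomial.sup_ker_aeval_eq_ker_aeval_mul_of_coprime Tc hpq, hprod,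
      LinearMap.ker_zero]
  have hJ₁ : ∀ k x, (N₂ ^ k) (op quatJ • x) = op quatJ • (N₁ ^ k) x := by
    intro k
    induction k with
    | zero => intro x; rfl
    | succ k ih =>
      intro x
      rw [pow_succ, pow_succ, Module.End.mul_apply, Module.End.mul_apply, ← ih, hN₁, hN₂, smul_sub,
        map_smul, smul_smul, smul_smul, ← op_mul, ← op_mul, coeComplex_mul_quatJ]
  have hJ₂ : ∀ k x, (N₁ ^ k) (op quatJ • x) = op quatJ • (N₂ ^ k) x := by
    intro k x
    have := hJ₁ k (op quatJ • x)
    rw [quatJ_smul_quatJ_smul, map_neg] at this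
    rw [← neg_inj, ← quatJ_smul_quatJ_smul, ← this, smul_neg]
  have hEE' : ∀ x ∈ E, op quatJ • x ∈ E' := by
    intro x hx
    rw [hE, LinearMap.mem_ker, hp] at hx
    rw [hE', LinearMap.mem_ker, hq, hJ₁, hx, smul_zero]
  have hE'E : ∀ x ∈ E', op quatJ • x ∈ E := by
    intro x hx
    rw [hE', LinearMap.mem_ker, hq] at hx
    rw [hE, LinearMap.mem_ker, hp, hJ₂, hx, smul_zero]
  have hmaps : ∀ x ∈ E, N₁ x ∈ E := by
    intro x hx
    rw [hE, LinearMap.mem_ker, hp] at hx ⊢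
    rw [← Module.End.mul_apply, ← pow_succ, pow_succ', Module.End.mul_apply, hx, map_zero]
  have hnil : IsNilpotent (N₁.restrict hmaps) := by
    refine ⟨m, ?_⟩
    ext ⟨x, hx⟩
    rw [Module.End.pow_restrict, LinearMap.restrict_apply]
    rw [hE, LinearMap.mem_ker, hp] at hx
    exact hx
  obtain ⟨C, _, len, v, hli, hsp, -, h0, hs⟩ := hnil.exists_chain_basis
  refine ⟨C, inferInstance, len, fun _ => μ, fun c k => v c k, ?_, ?_, fun c => hb.le, fun c => ?_,
    fun c k hk => ?_⟩
  · rw [Fintype.linearIndependent_iff] at hli ⊢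
    intro g hg
    -- write the coefficients as `z + w j`: the sum with coefficients `z` lies in `E`, and the rest,
    -- `(∑ v w) j`, lies in `E'`, so both vanish
    let z : (Σ c, Fin (len c)) → ℂ := fun s => ⟨(unop (g s)).re, (unop (g s)).imI⟩
    let w : (Σ c, Fin (len c)) → ℂ := fun s => ⟨(unop (g s)).imJ, (unop (g s)).imK⟩
    let X : E := ∑ s, z s • v s.1 s.2
    let Y : E := ∑ s, w s • v s.1 s.2
    have hX : (X : V) = ∑ s, op (coeComplex (z s)) • (v s.1 s.2 : V) := by
      simp [X, hsmul]
    have hY : (Y : V) = ∑ s, op (coeComplex (w s)) • (v s.1 s.2 : V) := by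
      simp [Y, hsmul]
    have hXY : (X : V) + op quatJ • (Y : V) = 0 := by
      rw [hX, hY, Finset.smul_sum, ← Finset.sum_add_distrib, ← hg]
      refine Finset.sum_congr rfl fun s _ => ?_
      exact (op_smul_eq (unop (g s)) (v s.1 s.2 : V)).symm
    have hX0 : (X : V) = 0 := by
      refine Submodule.disjoint_def.1 hdisj _ X.2 ?_
      rw [eq_neg_of_add_eq_zero_left hXY]
      exact E'.neg_mem (hEE' _ Y.2)
    have hY0 : (Y : V) = 0 := by
      rw [hX0, zero_add] at hXY
      rw [← neg_inj, ← quatJ_smul_quatJ_smul, hXY, smul_zero, neg_zero]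
    have hz := hli z (Subtype.ext hX0)
    have hw := hli w (Subtype.ext hY0)
    intro s
    apply unop_injective
    have h1 := hz s
    have h2 := hw s
    rw [Complex.ext_iff] at h1 h2
    ext
    · exact h1.1
    · exact h1.2
    · exact h2.1
    · exact h2.2
  · set S := Submodule.span ℍ[ℝ]ᵐᵒᵖ (Set.range fun s : Σ c, Fin (len c) => (v s.1 s.2 : V))
    -- the quaternionic span, as a complex subspace, contains `E` and therefore `E' = E j`
    let S' : Submodule ℂ V :=
      { S with smul_mem' := fun z x hx => S.smul_mem (op (coeComplex z)) hx }
    have hES : ∀ x ∈ E, x ∈ S := by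
      have h1 : (Submodule.span ℂ (Set.range fun s : Σ c, Fin (len c) => v s.1 s.2)).map
          E.subtype ≤ S' := by
        rw [Submodule.map_span_le]
        rintro _ ⟨s, rfl⟩
        exact Submodule.subset_span ⟨s, rfl⟩
      rw [hsp, Submodule.map_top, Submodule.range_subtype] at h1
      exact h1
    rw [eq_top_iff]
    intro x _
    obtain ⟨y, hy, y', hy', rfl⟩ := Submodule.mem_sup.1 (hsup.ge (Submodule.mem_top (x := x)))
    refine S.add_mem (hES y hy) ?_
    rw [← neg_neg y', ← quatJ_smul_quatJ_smul, smul_neg, smul_neg]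
    exact S.neg_mem (S.smul_mem _ (hES _ (hE'E _ hy')))
  · have := congrArg Subtype.val (h0 c)
    rw [LinearMap.coe_restrict_apply, hN₁] at this
    exact sub_eq_zero.1 this
  · have := congrArg Subtype.val (hs c k hk)
    rw [LinearMap.coe_restrict_apply, hN₁] at this
    exact sub_eq_iff_eq_add'.1 this

theorem HasJordanChainBasis.of_isCompl {T : Module.End ℍ[ℝ]ᵐᵒᵖ V} {p q : Submodule ℍ[ℝ]ᵐᵒᵖ V}
    (hpq : IsCompl p q) (hp : ∀ x ∈ p, T x ∈ p) (hq : ∀ x ∈ q, T x ∈ q)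
    (h₁ : HasJordanChainBasis (T.restrict hp)) (h₂ : HasJordanChainBasis (T.restrict hq)) :
    HasJordanChainBasis T := by
  obtain ⟨C₁, _, len₁, lam₁, v₁, hli₁, hsp₁, him₁, h0₁, hs₁⟩ := h₁
  obtain ⟨C₂, _, len₂, lam₂, v₂, hli₂, hsp₂, him₂, h0₂, hs₂⟩ := h₂
  let len : C₁ ⊕ C₂ → ℕ := Sum.elim len₁ len₂
  let v : C₁ ⊕ C₂ → ℕ → V := Sum.elim (fun c k => v₁ c k) (fun c k => v₂ c k)
  let e : (Σ c, Fin (len c)) ≃ (Σ c, Fin (len₁ c)) ⊕ (Σ c, Fin (len₂ c)) :=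
    Equiv.sumSigmaDistrib (fun c : C₁ ⊕ C₂ => Fin (len c))
  have he : (fun s : Σ c, Fin (len c) => v s.1 s.2) =
      Sum.elim (fun s : Σ c, Fin (len₁ c) => (v₁ s.1 s.2 : V))
        (fun s : Σ c, Fin (len₂ c) => (v₂ s.1 s.2 : V)) ∘ e := by
    funext s
    rcases s with ⟨c | c, k⟩ <;> rfl
  have hsp₁' : Submodule.span ℍ[ℝ]ᵐᵒᵖ (Set.range fun s : Σ c, Fin (len₁ c) => (v₁ s.1 s.2 : V)) =
      p := by
    have := congrArg (Submodule.map p.subtype) hsp₁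
    rwa [Submodule.map_span, Submodule.map_top, Submodule.range_subtype, ← Set.range_comp] at this
  have hsp₂' : Submodule.span ℍ[ℝ]ᵐᵒᵖ (Set.range fun s : Σ c, Fin (len₂ c) => (v₂ s.1 s.2 : V)) =
      q := by
    have := congrArg (Submodule.map q.subtype) hsp₂
    rwa [Submodule.map_span, Submodule.map_top, Submodule.range_subtype, ← Set.range_comp] at this
  refine ⟨C₁ ⊕ C₂, inferInstance, len, Sum.elim lam₁ lam₂, v, ?_, ?_, ?_, ?_, ?_⟩
  · rw [he, linearIndependent_equiv]
    refine LinearIndependent.sum_type (hli₁.map' p.subtype p.ker_subtype)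
      (hli₂.map' q.subtype q.ker_subtype) ?_
    change Disjoint (Submodule.span ℍ[ℝ]ᵐᵒᵖ (Set.range fun s : Σ c, Fin (len₁ c) =>
      (v₁ s.1 s.2 : V))) (Submodule.span ℍ[ℝ]ᵐᵒᵖ (Set.range fun s : Σ c, Fin (len₂ c) =>
      (v₂ s.1 s.2 : V)))
    rw [hsp₁', hsp₂']
    exact hpq.disjoint
  · rw [he, e.surjective.range_comp, Set.Sum.elim_range, Submodule.span_union, hsp₁', hsp₂',
      hpq.sup_eq_top]
  · rintro (c | c)
    exacts [him₁ c, him₂ c]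
  · rintro (c | c)
    exacts [congrArg Subtype.val (h0₁ c), congrArg Subtype.val (h0₂ c)]
  · rintro (c | c) k hk
    exacts [congrArg Subtype.val (hs₁ c k hk), congrArg Subtype.val (hs₂ c k hk)]

/-- An eigenvector over `ℂ`, with eigenvalue `a + b i`, is in the kernel of `(T - a)² + b²`. -/
theorem exists_quadraticEnd_apply_eq_zero [FiniteDimensional ℍ[ℝ]ᵐᵒᵖ V] [Nontrivial V]
    (T : Module.End ℍ[ℝ]ᵐᵒᵖ V) : ∃ (a b : ℝ) (x : V), x ≠ 0 ∧ quadraticEnd T a b x = 0 := by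
  let := rightComplexModule V
  have : FiniteDimensional ℂ V := finiteDimensional_complex
  have hsmul : ∀ (z : ℂ) (x : V), z • x = op (coeComplex z) • x := fun _ _ => rfl
  obtain ⟨μ, hμ⟩ := Module.End.exists_eigenvalue (toComplexEnd T)
  obtain ⟨x, hx⟩ := hμ.exists_hasEigenvector
  have hTx : T x = μ • x := hx.apply_eq_smul
  have hT : ∀ z : ℂ, T (z • x) = z • μ • x := fun z => by
    rw [hsmul, map_smul, hTx]; rfl
  refine ⟨μ.re, μ.im, x, hx.2, ?_⟩
  simp only [quadraticEnd, pow_two (T - _), LinearMap.add_apply, Module.End.mul_apply,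
    LinearMap.sub_apply, realScale_apply, ← coeComplex_coe, ← hsmul, hTx, hT, smul_smul,
    ← sub_smul, ← add_smul]
  convert zero_smul ℂ x
  apply Complex.ext
  · simp [pow_two]
  · simp [pow_two, mul_comm]

/-- By Fitting's decomposition with respect to `(T - a)² + b²`, where `a ± b i` are eigenvalues,
and induction on the dimension. -/
theorem hasJordanChainBasis [FiniteDimensional ℍ[ℝ]ᵐᵒᵖ V] (T : Module.End ℍ[ℝ]ᵐᵒᵖ V) :
    HasJordanChainBasis T := by
  induction hd : finrank ℍ[ℝ]ᵐᵒᵖ V using Nat.strong_induction_on generalizing V with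
  | _ d ih =>
  subst hd
  rcases subsingleton_or_nontrivial V with hV | hV
  · exact ⟨Empty, inferInstance, fun c => c.elim, fun c => c.elim, fun c => c.elim,
      linearIndependent_empty_type, Subsingleton.elim _ _, fun c => c.elim, fun c => c.elim,
      fun c => c.elim⟩
  obtain ⟨a, b, x, hx, hSx⟩ := exists_quadraticEnd_apply_eq_zero T
  set S := quadraticEnd T a b with hS
  by_cases hnil : IsNilpotent S
  · rcases eq_or_ne b 0 with rfl | hb
    · refine hasJordanChainBasis_of_isNilpotent_sub T a ?_
      have h0 : realScale V ((0 : ℝ) ^ 2) = 0 := by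
        ext y; simp [realScale_apply]
      rw [hS, quadraticEnd, h0, add_zero] at hnil
      exact (IsNilpotent.pow_iff_pos two_ne_zero).1 hnil
    · refine hasJordanChainBasis_of_isNilpotent_quadraticEnd T a |b| (abs_pos.2 hb) ?_
      rwa [quadraticEnd, sq_abs]
  · obtain ⟨k, hk, hk1⟩ := (S.eventually_isCompl_ker_pow_range_pow.and
      (Filter.eventually_ge_atTop 1)).exists
    have hcomm : Commute T (S ^ k) := (commute_quadraticEnd T a b).pow_right k
    have hTS : ∀ y, T ((S ^ k) y) = (S ^ k) (T y) := fun y => LinearMap.congr_fun hcomm y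
    have hp : ∀ y ∈ LinearMap.ker (S ^ k), T y ∈ LinearMap.ker (S ^ k) := by
      intro y hy
      rw [LinearMap.mem_ker] at hy ⊢
      rw [← hTS, hy, map_zero]
    have hq : ∀ y ∈ LinearMap.range (S ^ k), T y ∈ LinearMap.range (S ^ k) := by
      rintro _ ⟨y, rfl⟩
      exact ⟨T y, (hTS y).symm⟩
    have hxk : x ∈ LinearMap.ker (S ^ k) := by
      obtain ⟨l, rfl⟩ := Nat.exists_eq_add_of_le' hk1
      rw [LinearMap.mem_ker, pow_succ, Module.End.mul_apply, hSx, map_zero]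
    have h1 : LinearMap.ker (S ^ k) ≠ ⊤ := fun h => hnil ⟨k, LinearMap.ker_eq_top.1 h⟩
    have h2 : LinearMap.range (S ^ k) ≠ ⊤ := fun h => by
      have h3 := hk.disjoint
      rw [h, disjoint_top] at h3
      rw [h3] at hxk
      exact hx hxk
    exact .of_isCompl hk hp hq (ih _ (Submodule.finrank_lt h1) _ rfl)
      (ih _ (Submodule.finrank_lt h2) _ rfl)

end RightQuaternionSpaces

/-! ### The Jordan form of a quaternion matrix -/

section JordanForm

/-- The right linear map `x ↦ A x` on columns. -/
noncomputable def mulVecEnd {n : ℕ} (A : Matrix (Fin n) (Fin n) ℍ[ℝ]) :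
    Module.End ℍ[ℝ]ᵐᵒᵖ (Fin n → ℍ[ℝ]) where
  toFun := A.mulVec
  map_add' := A.mulVec_add
  map_smul' d x := A.mulVec_smul d x

/-- `ℍ` and its opposite ring are isomorphic as right quaternionic spaces. -/
noncomputable def quatOpLinearEquiv : ℍ[ℝ] ≃ₗ[ℍ[ℝ]ᵐᵒᵖ] ℍ[ℝ]ᵐᵒᵖ where
  __ := opAddEquiv
  map_smul' _ _ := rfl

instance finiteDimensional_columns (n : ℕ) : FiniteDimensional ℍ[ℝ]ᵐᵒᵖ (Fin n → ℍ[ℝ]) :=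
  Module.Finite.equiv (LinearEquiv.piCongrRight fun _ : Fin n => quatOpLinearEquiv.symm)

theorem finrank_columns (n : ℕ) : finrank ℍ[ℝ]ᵐᵒᵖ (Fin n → ℍ[ℝ]) = n := by
  rw [(LinearEquiv.piCongrRight fun _ : Fin n => quatOpLinearEquiv).finrank_eq]
  simp

/-- Blocks of lengths `len c` can be laid out one after the other in `Fin n`. -/
theorem exists_block_equiv {C : Type*} [Fintype C] (len : C → ℕ) {n : ℕ} (h : ∑ c, len c = n) :
    ∃ (e : (Σ c, Fin (len c)) ≃ Fin n) (start : C → ℕ), ∀ s, (e s : ℕ) = start s.1 + s.2 := by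
  let f := Fintype.equivFin C
  let g : (Σ i, Fin (len (f.symm i))) ≃ Σ c, Fin (len c) :=
    Equiv.sigmaCongrLeft (β := fun c => Fin (len c)) f.symm
  have hN : ∑ i, len (f.symm i) = n := by rw [← h, f.symm.sum_comp]
  let start : Fin (Fintype.card C) → ℕ := fun i => ∑ j : Fin i, len (f.symm (Fin.castLE i.2.le j))
  refine ⟨g.symm.trans (finSigmaFinEquiv.trans (finCongr hN)), fun c => start (f c), fun s => ?_⟩
  obtain ⟨⟨i, k⟩, rfl⟩ := g.surjective s
  have hg : g ⟨i, k⟩ = ⟨f.symm i, k⟩ := rfl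
  change ((finSigmaFinEquiv (g.symm (g ⟨i, k⟩)) : Fin _) : ℕ) = _
  rw [Equiv.symm_apply_apply, finSigmaFinEquiv_apply, hg]
  change start i + (k : ℕ) = start (f (f.symm i)) + (k : ℕ)
  rw [Equiv.apply_symm_apply]

/-- The columns of `P` are the chain vectors, enumerated chain by chain; `Q` holds the coordinates
of the standard basis vectors. -/
theorem exists_isJordanFormOf {n : ℕ} (A : Matrix (Fin n) (Fin n) ℍ[ℝ]) :
    ∃ J : Matrix (Fin n) (Fin n) ℂ, IsJordanFormOf J A := by
  obtain ⟨C, _, len, lam, v, hli, hsp, him, h0, hs⟩ := hasJordanChainBasis (mulVecEnd A)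
  let b := Basis.mk hli hsp.ge
  have hb : ∀ s, b s = v s.1 s.2 := fun s => by simp [b]
  have hcard : ∑ c, len c = n := by
    have := finrank_eq_card_basis b
    rw [finrank_columns] at this
    simpa using this.symm
  obtain ⟨e, start, he⟩ := exists_block_equiv len hcard
  classical
  let J : Matrix (Fin n) (Fin n) ℂ := fun i j =>
    if i = j then lam (e.symm i).1
    else if (e.symm i).1 = (e.symm j).1 ∧ (j : ℕ) = i + 1 then 1 else 0
  have hJd : ∀ i, J i i = lam (e.symm i).1 := fun i => if_pos rfl
  let P : Matrix (Fin n) (Fin n) ℍ[ℝ] := fun i j => b (e.symm j) i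
  let Q : Matrix (Fin n) (Fin n) ℍ[ℝ] := fun i j => unop (b.repr (Pi.single j 1) (e.symm i))
  have hPQ : P * Q = 1 := by
    ext1 r j
    have h1 := congrFun (b.sum_repr (Pi.single j 1)) r
    rw [Matrix.mul_apply, Matrix.one_apply, ← Pi.single_apply, ← h1,
      ← e.symm.sum_comp, Finset.sum_apply]
    rfl
  have hQP : Q * P = 1 := mul_eq_one_comm.1 hPQ
  -- the columns of `A P = P J`, read along the chains
  have hcol : ∀ s r, A.mulVec (b s) r = ∑ i, P r i * coeComplex (J i (e s)) := by
    rintro ⟨c, k, hk⟩ r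
    have hd : coeComplex (J (e ⟨c, ⟨k, hk⟩⟩) (e ⟨c, ⟨k, hk⟩⟩)) = coeComplex (lam c) := by
      rw [hJd, Equiv.symm_apply_apply]
    have hPd : P r (e ⟨c, ⟨k, hk⟩⟩) = v c k r := by
      change b (e.symm (e _)) r = _
      rw [Equiv.symm_apply_apply, hb]
    rw [hb]
    rcases k with _ | k
    · rw [Finset.sum_eq_single (e ⟨c, ⟨0, hk⟩⟩), hd, hPd]
      · exact congrFun (h0 c) r
      · intro i _ hi
        have : J i (e ⟨c, ⟨0, hk⟩⟩) = 0 := by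
          simp only [J, if_neg hi]
          refine if_neg ?_
          rintro ⟨h1, h2⟩
          have h3 := he (e.symm i)
          rw [Equiv.apply_symm_apply] at h3
          have h4 := he ⟨c, ⟨0, hk⟩⟩
          have h5 : start (e.symm i).1 = start c := by rw [h1, Equiv.symm_apply_apply]
          simp only at h4
          omega
        rw [this, coeComplex_zero, mul_zero]
      · simp
    · have h3 := he ⟨c, ⟨k, by omega⟩⟩
      have h4 := he ⟨c, ⟨k + 1, hk⟩⟩
      have hne : e ⟨c, ⟨k + 1, hk⟩⟩ ≠ e ⟨c, ⟨k, by omega⟩⟩ := by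
        intro h
        have := congrArg Fin.val h
        simp only at h3 h4
        omega
      have h1 : J (e ⟨c, ⟨k, by omega⟩⟩) (e ⟨c, ⟨k + 1, hk⟩⟩) = 1 := by
        simp only [J, if_neg hne.symm]
        refine if_pos ⟨by simp, ?_⟩
        simp only at h3 h4
        omega
      rw [Finset.sum_eq_add _ _ hne, hd, hPd, h1, coeComplex_one, mul_one]
      · have := congrFun (hs c k hk) r
        refine this.trans (congrArg (v c (k + 1) r * coeComplex (lam c) + ·) ?_)
        change _ = b (e.symm (e _)) r
        rw [Equiv.symm_apply_apply, hb]
      · intro i _ hi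
        have : J i (e ⟨c, ⟨k + 1, hk⟩⟩) = 0 := by
          simp only [J, if_neg hi.1]
          refine if_neg ?_
          rintro ⟨-, h2⟩
          refine hi.2 (Fin.ext ?_)
          simp only at h3 h4
          omega
        rw [this, coeComplex_zero, mul_zero]
      · simp
      · simp
  have hAP : A * P = P * J.map coeComplex := by
    ext1 r j
    have := hcol (e.symm j) r
    rw [Equiv.apply_symm_apply] at this
    rw [Matrix.mul_apply, Matrix.mul_apply]
    exact this
  refine ⟨J, ⟨fun i j h1 h2 => ?_, fun i j h => ?_⟩, fun i => ?_, ⟨P, Q, hPQ, hQP⟩, ?_⟩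
  · have hne : i ≠ j := fun h => h1 (by rw [h])
    simp only [J, if_neg hne]
    exact if_neg fun h => h2 h.2
  · have hne : i ≠ j := fun h' => by rw [h'] at h; omega
    by_cases hc : (e.symm i).1 = (e.symm j).1
    · right
      rw [hJd, hJd, hc]
      refine ⟨?_, rfl⟩
      simp only [J, if_neg hne]
      exact if_pos ⟨hc, h⟩
    · left
      simp only [J, if_neg hne]
      exact if_neg fun h => hc h.1
  · rw [hJd]; exact him _
  · change Q * A * P = _
    rw [Matrix.mul_assoc, hAP, ← Matrix.mul_assoc, hQP, Matrix.one_mul]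

end JordanForm

/-! ### Eigenvalues and multiplicities of Jordan matrices -/

section Bidiagonal

variable {R : Type*} [NonUnitalNonAssocSemiring R] {n : ℕ} {M : Matrix (Fin n) (Fin n) R}

theorem mulVec_apply_of_bidiagonal
    (hM : ∀ i j : Fin n, (j : ℕ) ≠ i → (j : ℕ) ≠ i + 1 → M i j = 0) (x : Fin n → R) {i j : Fin n}
    (hij : (j : ℕ) = i + 1) : M.mulVec x i = M i i * x i + M i j * x j := by
  have hne : i ≠ j := fun h => by rw [h] at hij; omega
  refine Finset.sum_eq_add i j hne (fun k _ hk => ?_)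
    (fun h => (h (Finset.mem_univ _)).elim) fun h => (h (Finset.mem_univ _)).elim
  change M i k * x k = 0
  rw [hM i k (fun h => hk.1 (Fin.ext h)) (fun h => hk.2 (Fin.ext (h.trans hij.symm))), zero_mul]

theorem mulVec_apply_of_bidiagonal_last
    (hM : ∀ i j : Fin n, (j : ℕ) ≠ i → (j : ℕ) ≠ i + 1 → M i j = 0) (x : Fin n → R) {i : Fin n}
    (hi : ∀ j : Fin n, (j : ℕ) ≠ i + 1) : M.mulVec x i = M i i * x i := by
  refine Finset.sum_eq_single i (fun k _ hk => ?_)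
    fun h => (h (Finset.mem_univ _)).elim
  change M i k * x k = 0
  rw [hM i k (fun h => hk (Fin.ext h)) (hi k), zero_mul]

end Bidiagonal

section Multiplicities

variable {n : ℕ} {J : Matrix (Fin n) (Fin n) ℂ}

theorem IsJordanMatrix.sub_smul_one_bidiagonal (hJ : IsJordanMatrix J) (z : ℂ) (i j : Fin n)
    (h₁ : (j : ℕ) ≠ i) (h₂ : (j : ℕ) ≠ i + 1) :
    (J - z • (1 : Matrix (Fin n) (Fin n) ℂ)) i j = 0 := by
  have : i ≠ j := fun h => h₁ (by rw [h])
  simp [hJ.1 i j h₁ h₂, this]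

/-- The eigenvectors of a Jordan matrix for `z` are supported where the diagonal entry is `z`. -/
theorem IsJordanMatrix.ker_le (hJ : IsJordanMatrix J) (z : ℂ) :
    LinearMap.ker (Matrix.mulVecLin (J - z • (1 : Matrix (Fin n) (Fin n) ℂ))) ≤
      LinearMap.ker (Matrix.mulVecLin (Matrix.diagonal fun i => J i i - z)) := by
  intro x hx
  rw [LinearMap.mem_ker, Matrix.mulVecLin_apply] at hx ⊢
  have hx' : ∀ i, (J - z • (1 : Matrix (Fin n) (Fin n) ℂ)).mulVec x i = 0 := congrFun hx
  have key : ∀ (k : ℕ) (i : Fin n), n - i = k → J i i ≠ z → x i = 0 := by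
    intro k
    induction k using Nat.strong_induction_on with
    | _ k ih =>
    intro i hk hi
    have hi' : J i i - z ≠ 0 := sub_ne_zero.2 hi
    by_cases h : ∃ j : Fin n, (j : ℕ) = i + 1
    · obtain ⟨j, hj⟩ := h
      have hne : i ≠ j := fun h => by rw [h] at hj; omega
      have h1 := hx' i
      rw [mulVec_apply_of_bidiagonal (hJ.sub_smul_one_bidiagonal z) x hj] at h1
      have h2 : J i j * x j = 0 := by
        rcases hJ.2 i j hj with h0 | ⟨-, h0⟩
        · rw [h0, zero_mul]
        · rw [ih (n - j) (by omega) j rfl (h0 ▸ hi), mul_zero]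
      simpa [hne, h2, hi'] using h1
    · push Not at h
      have h1 := hx' i
      rw [mulVec_apply_of_bidiagonal_last (hJ.sub_smul_one_bidiagonal z) x h] at h1
      simpa [hi'] using h1
  funext i
  rw [Matrix.mulVec_diagonal, Pi.zero_apply]
  by_cases hi : J i i = z
  · rw [hi, sub_self, zero_mul]
  · rw [key _ i rfl hi, mul_zero]

theorem finrank_ker_diagonal_sub (J : Matrix (Fin n) (Fin n) ℂ) (z : ℂ) :
    finrank ℂ (LinearMap.ker (Matrix.mulVecLin (Matrix.diagonal fun i => J i i - z))) =
      algebraicMultiplicity J z := by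
  classical
  have h1 := LinearMap.finrank_range_add_finrank_ker
    (Matrix.mulVecLin (Matrix.diagonal fun i => J i i - z))
  have h2 := Matrix.rank_diagonal fun i => J i i - z
  rw [Matrix.rank] at h2
  rw [h2, finrank_fintype_fun_eq_card] at h1
  have h3 := Fintype.card_subtype_compl fun i => J i i - z = 0
  have h4 := Fintype.card_subtype_le fun i => J i i - z = 0
  have h5 : algebraicMultiplicity J z = Fintype.card {i // J i i - z = 0} := by
    rw [algebraicMultiplicity, Nat.card_eq_fintype_card]
    exact Fintype.card_congr (Equiv.subtypeEquivRight fun i => sub_eq_zero.symm)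
  simp only [ne_eq] at h1
  omega

/-- The two multiplicities of `z` agree exactly when all Jordan blocks for `z` have size `1`. -/
theorem IsJordanMatrix.algebraicMultiplicity_eq_iff (hJ : IsJordanMatrix J) (z : ℂ) :
    algebraicMultiplicity J z = geometricMultiplicity J z ↔
      ∀ i j : Fin n, (j : ℕ) = i + 1 → J i i = z → J i j = 0 := by
  rw [← finrank_ker_diagonal_sub, geometricMultiplicity]
  constructor
  · intro h i j hij hi
    by_contra h0
    have hjj : J j j = z := by
      rcases hJ.2 i j hij with h1 | h1
      exacts [(h0 h1).elim, h1.2 ▸ hi]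
    have hne : i ≠ j := fun h => by rw [h] at hij; omega
    have heq := Submodule.eq_of_le_of_finrank_eq (hJ.ker_le z) h.symm
    have hmem : (Pi.single j 1 : Fin n → ℂ) ∈
        LinearMap.ker (Matrix.mulVecLin (Matrix.diagonal fun i => J i i - z)) := by
      rw [LinearMap.mem_ker, Matrix.mulVecLin_apply, Matrix.diagonal_mulVec_single, hjj, sub_self,
        zero_mul, Pi.single_zero]
    rw [← heq, LinearMap.mem_ker, Matrix.mulVecLin_apply] at hmem
    have := congrFun hmem i
    rw [Matrix.mulVec_single_one] at this
    simp [hne] at this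
    exact h0 this
  · intro h
    refine congrArg (fun K : Submodule ℂ (Fin n → ℂ) => finrank ℂ K)
      (le_antisymm (fun x hx => ?_) (hJ.ker_le z))
    rw [LinearMap.mem_ker, Matrix.mulVecLin_apply] at hx ⊢
    have hx' : ∀ i, (J i i - z) * x i = 0 := fun i => by
      have := congrFun hx i
      rwa [Matrix.mulVec_diagonal] at this
    funext i
    by_cases hi : ∃ j : Fin n, (j : ℕ) = i + 1
    · obtain ⟨j, hj⟩ := hi
      have hne : i ≠ j := fun h => by rw [h] at hj; omega
      rw [mulVec_apply_of_bidiagonal (hJ.sub_smul_one_bidiagonal z) x hj]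
      have h2 : J i j * x j = 0 := by
        rcases hJ.2 i j hj with h0 | ⟨h1, h0⟩
        · rw [h0, zero_mul]
        · have h3 : J j j ≠ z := fun h3 => by
            rw [h i j hj (h0.trans h3)] at h1
            exact zero_ne_one h1
          rw [(mul_eq_zero.1 (hx' j)).resolve_left (sub_ne_zero.2 h3), mul_zero]
      simpa [hne, h2] using hx' i
    · push Not at hi
      rw [mulVec_apply_of_bidiagonal_last (hJ.sub_smul_one_bidiagonal z) x hi]
      simpa using hx' i

end Multiplicities

section Eigenvalues

variable {n : ℕ} {J : Matrix (Fin n) (Fin n) ℂ} {A : Matrix (Fin n) (Fin n) ℍ[ℝ]}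

theorem coeComplex_injective : Function.Injective coeComplex := fun _ _ h =>
  Complex.ext (congrArg QuaternionAlgebra.re h) (congrArg QuaternionAlgebra.imI h)

/-- Each similarity class of quaternions meets the closed upper half plane at most once. -/
theorem eq_of_coeComplex_mul_eq_mul_coeComplex {a b : ℂ} {q : ℍ[ℝ]} (hq : q ≠ 0) (ha : 0 ≤ a.im)
    (hb : 0 ≤ b.im) (h : coeComplex a * q = q * coeComplex b) : a = b := by
  have h0 := congrArg QuaternionAlgebra.re h
  have h1 := congrArg QuaternionAlgebra.imI h
  have h2 := congrArg QuaternionAlgebra.imJ h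
  have h3 := congrArg QuaternionAlgebra.imK h
  simp at h0 h1 h2 h3
  by_contra hab
  -- with `q = u + v j`, the equation reads `a u = u b` and `a v = v b̄`
  have e1 : (a - b) * (⟨q.re, q.imI⟩ : ℂ) = 0 := by
    apply Complex.ext <;> simp <;> linarith
  have e2 : (a - (starRingEnd ℂ) b) * (⟨q.imJ, q.imK⟩ : ℂ) = 0 := by
    apply Complex.ext <;> simp <;> linarith
  have e3 := (mul_eq_zero.1 e1).resolve_left (sub_ne_zero.2 hab)
  rcases mul_eq_zero.1 e2 with e4 | e4
  · have h4 := congrArg Complex.re e4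
    have h5 := congrArg Complex.im e4
    simp at h4 h5
    exact hab (Complex.ext (by linarith) (by linarith))
  · rw [Complex.ext_iff] at e3 e4
    exact hq (QuaternionAlgebra.ext e3.1 e3.2 e4.1 e4.2)

theorem mulVec_mul_right (M : Matrix (Fin n) (Fin n) ℍ[ℝ]) (x : Fin n → ℍ[ℝ]) (q : ℍ[ℝ]) :
    M.mulVec (fun i => x i * q) = fun i => M.mulVec x i * q :=
  M.mulVec_smul (op q) x

theorem map_coeComplex_mulVec (M : Matrix (Fin n) (Fin n) ℂ) (u : Fin n → ℂ) :
    (M.map coeComplex).mulVec (fun i => coeComplex (u i)) = fun i => coeComplex (M.mulVec u i) := by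
  funext i
  exact (RingHom.map_mulVec (Quaternion.ofComplex : ℂ →+* ℍ[ℝ]) M u i).symm

theorem IsJordanMatrix.map_bidiagonal (hJ : IsJordanMatrix J) (i j : Fin n)
    (h₁ : (j : ℕ) ≠ i) (h₂ : (j : ℕ) ≠ i + 1) : (J.map coeComplex) i j = 0 := by
  rw [Matrix.map_apply, hJ.1 i j h₁ h₂, coeComplex_zero]

theorem IsJordanMatrix.exists_eigenvector (hJ : IsJordanMatrix J) (i : Fin n) :
    ∃ u : Fin n → ℂ, u ≠ 0 ∧ J.mulVec u = J i i • u := by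
  have hdet : (J - J i i • (1 : Matrix (Fin n) (Fin n) ℂ)).det = 0 := by
    rw [Matrix.det_of_isUpperTriangular]
    · exact Finset.prod_eq_zero (Finset.mem_univ i) (by simp)
    · intro a b hab
      have hab' : (b : ℕ) < a := hab
      exact hJ.sub_smul_one_bidiagonal _ a b (by omega) (by omega)
  obtain ⟨u, hu, h⟩ := Matrix.exists_mulVec_eq_zero_iff.2 hdet
  refine ⟨u, hu, ?_⟩
  rwa [Matrix.sub_mulVec, Matrix.smul_mulVec, Matrix.one_mulVec, sub_eq_zero] at h

theorem isStandardEigenvalue_iff (hJ : IsJordanFormOf J A) (z : ℂ) :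
    IsStandardEigenvalue A z ↔ ∃ i, J i i = z := by
  obtain ⟨hJm, him, P, hP⟩ := hJ
  constructor
  · rintro ⟨hz, η, hη, hAη⟩
    set Q := ((P⁻¹ : (Matrix (Fin n) (Fin n) ℍ[ℝ])ˣ) : Matrix (Fin n) (Fin n) ℍ[ℝ]) with hQ
    set y := Q.mulVec η with hy
    have hPy : (P : Matrix (Fin n) (Fin n) ℍ[ℝ]).mulVec y = η := by
      rw [hy, Matrix.mulVec_mulVec, hQ, Units.mul_inv, Matrix.one_mulVec]
    have hJy : (J.map coeComplex).mulVec y = fun i => y i * coeComplex z := by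
      rw [← hP, ← Matrix.mulVec_mulVec, hPy, ← Matrix.mulVec_mulVec, hAη, mulVec_mul_right]
    have hy0 : y ≠ 0 := fun h => hη (by rw [← hPy, h, Matrix.mulVec_zero])
    -- compare the equations in the last nonzero coordinate of `y`
    classical
    obtain ⟨i₀, hi₀⟩ := Function.ne_iff.1 hy0
    obtain ⟨i, hi, hmax⟩ := (Finset.univ.filter fun i => y i ≠ 0).exists_max_image
      (fun i : Fin n => i) ⟨i₀, by simpa using hi₀⟩
    have hyi : y i ≠ 0 := by simpa using hi
    have hrow : (J.map coeComplex).mulVec y i = coeComplex (J i i) * y i := by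
      by_cases h : ∃ j : Fin n, (j : ℕ) = i + 1
      · obtain ⟨j, hj⟩ := h
        have hyj : y j = 0 := by
          by_contra hyj
          have : j ≤ i := hmax j (by simpa using hyj)
          rw [Fin.le_def] at this
          omega
        rw [mulVec_apply_of_bidiagonal hJm.map_bidiagonal y hj, hyj, mul_zero, add_zero,
          Matrix.map_apply]
      · push Not at h
        rw [mulVec_apply_of_bidiagonal_last hJm.map_bidiagonal y h, Matrix.map_apply]
    refine ⟨i, eq_of_coeComplex_mul_eq_mul_coeComplex hyi (him i) hz ?_⟩
    rw [← hrow, hJy]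
  · rintro ⟨i, rfl⟩
    obtain ⟨u, hu, hJu⟩ := hJm.exists_eigenvector i
    refine ⟨him i, (P : Matrix (Fin n) (Fin n) ℍ[ℝ]).mulVec fun k => coeComplex (u k),
      fun h => ?_, ?_⟩
    · have := congrArg (((P⁻¹ : (Matrix (Fin n) (Fin n) ℍ[ℝ])ˣ) :
        Matrix (Fin n) (Fin n) ℍ[ℝ]).mulVec) h
      rw [Matrix.mulVec_mulVec, Units.inv_mul, Matrix.one_mulVec, Matrix.mulVec_zero] at this
      exact hu (funext fun k => coeComplex_injective ((congrFun this k).trans coeComplex_zero.symm))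
    · have hAP : A * P = P * J.map coeComplex := by
        rw [← hP, ← Matrix.mul_assoc, ← Matrix.mul_assoc, Units.mul_inv, Matrix.one_mul]
      rw [Matrix.mulVec_mulVec, hAP, ← Matrix.mulVec_mulVec, map_coeComplex_mulVec, hJu,
        ← mulVec_mul_right]
      congr 1
      funext k
      rw [Pi.smul_apply, smul_eq_mul, mul_comm, coeComplex_mul]

end Eigenvalues

/-! ### Linear systems: flow and criteria for stability -/

section LinearSystems

/-- The flow `exp (s L)` of the linear equation `x' = L x` on a Banach space. -/
noncomputable def linearFlow {E : Type*} [NormedAddCommGroup E] [NormedSpace ℝ E]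
    (L : E →L[ℝ] E) (s : ℝ) : E →L[ℝ] E :=
  NormedSpace.exp (s • L)

theorem linearFlow_zero {E : Type*} [NormedAddCommGroup E] [NormedSpace ℝ E]
    (L : E →L[ℝ] E) : linearFlow L 0 = ContinuousLinearMap.id ℝ E := by
  rw [linearFlow, zero_smul, NormedSpace.exp_zero]
  rfl

theorem hasDerivAt_linearFlow {E : Type*} [NormedAddCommGroup E] [NormedSpace ℝ E]
    [CompleteSpace E] (L : E →L[ℝ] E) (x : E) (t₀ t : ℝ) :
    HasDerivAt (fun t => linearFlow L (t - t₀) x) (L (linearFlow L (t - t₀) x)) t := by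
  have h1 := (hasDerivAt_exp_smul_const' L (t - t₀)).scomp t ((hasDerivAt_id t).sub_const t₀)
  have h2 := h1.clm_apply (hasDerivAt_const t x)
  simpa [linearFlow, Function.comp_def] using h2

variable {n : ℕ}

/-- The map `x ↦ A x` as a continuous real linear map. -/
noncomputable def mulVecCLM (A : Matrix (Fin n) (Fin n) ℍ[ℝ]) :
    (Fin n → ℍ[ℝ]) →L[ℝ] (Fin n → ℍ[ℝ]) :=
  LinearMap.toContinuousLinearMap
    { toFun := A.mulVec
      map_add' := A.mulVec_add
      map_smul' := fun r x => A.mulVec_smul r x }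

theorem mulVecCLM_apply (A : Matrix (Fin n) (Fin n) ℍ[ℝ]) (x : Fin n → ℍ[ℝ]) :
    mulVecCLM A x = A.mulVec x := rfl

theorem norm_le_vecNorm (x : Fin n → ℍ[ℝ]) : ‖x‖ ≤ vecNorm x :=
  (pi_norm_le_iff_of_nonneg (Finset.sum_nonneg fun _ _ => norm_nonneg _)).2 fun i =>
    Finset.single_le_sum (f := fun k => ‖x k‖) (fun _ _ => norm_nonneg _) (Finset.mem_univ i)

theorem vecNorm_le (x : Fin n → ℍ[ℝ]) : vecNorm x ≤ n * ‖x‖ := by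
  refine (Finset.sum_le_card_nsmul _ _ ‖x‖ fun i _ => norm_le_pi_norm x i).trans ?_
  simp

theorem vecNorm_smul (c : ℝ) (x : Fin n → ℍ[ℝ]) : vecNorm (c • x) = |c| * vecNorm x := by
  simp [vecNorm, Finset.mul_sum, norm_smul]

theorem vecNorm_nonneg (x : Fin n → ℍ[ℝ]) : 0 ≤ vecNorm x :=
  Finset.sum_nonneg fun _ _ => norm_nonneg _

theorem tendsto_vecNorm_iff {f : ℝ → Fin n → ℍ[ℝ]} :
    Filter.Tendsto (fun t => vecNorm (f t)) Filter.atTop (nhds 0) ↔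
      Filter.Tendsto f Filter.atTop (nhds 0) := by
  rw [tendsto_zero_iff_norm_tendsto_zero (f := f)]
  constructor
  · exact squeeze_zero (fun t => norm_nonneg _) fun t => norm_le_vecNorm _
  · intro h
    refine squeeze_zero (fun t => vecNorm_nonneg _) (fun t => vecNorm_le _) ?_
    simpa using h.const_mul (n : ℝ)

variable {A B : Matrix (Fin n) (Fin n) ℍ[ℝ]} {t₀ : ℝ} {φ ψ : ℝ → Fin n → ℍ[ℝ]}

theorem isSolution_zero : IsSolution (constantField A) t₀ fun _ => 0 := by
  intro t _
  simpa [constantField] using hasDerivWithinAt_const t (Set.Ici t₀) (0 : Fin n → ℍ[ℝ])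

theorem IsSolution.sub (hφ : IsSolution (constantField A) t₀ φ)
    (hψ : IsSolution (constantField A) t₀ ψ) :
    IsSolution (constantField A) t₀ fun t => φ t - ψ t := by
  intro t ht
  have := (hφ t ht).fun_sub (hψ t ht)
  simpa only [constantField, Matrix.mulVec_sub] using this

/-- If `Q A = B Q`, then `Q` maps solutions of `x' = A x` to solutions of `y' = B y`. -/
theorem IsSolution.mulVec {Q : Matrix (Fin n) (Fin n) ℍ[ℝ]} (hQ : Q * A = B * Q)
    (hφ : IsSolution (constantField A) t₀ φ) :
    IsSolution (constantField B) t₀ fun t => Q.mulVec (φ t) := by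
  intro t ht
  have := (mulVecCLM Q).hasFDerivAt.comp_hasDerivWithinAt t (hφ t ht)
  simp only [constantField, mulVecCLM_apply, Matrix.mulVec_mulVec, hQ] at this ⊢
  exact this

theorem IsSolution.const_smul (c : ℝ) (hφ : IsSolution (constantField A) t₀ φ) :
    IsSolution (constantField A) t₀ fun t => c • φ t := by
  intro t ht
  have := (hφ t ht).fun_const_smul c
  simpa only [constantField, Matrix.mulVec_smul] using this

/-- The solution with initial value `x` is `exp ((t - t₀) A) x`. -/
theorem isSolution_linearFlow (A : Matrix (Fin n) (Fin n) ℍ[ℝ]) (t₀ : ℝ) (x : Fin n → ℍ[ℝ]) :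
    IsSolution (constantField A) t₀ fun t => linearFlow (mulVecCLM A) (t - t₀) x :=
  fun t _ => (hasDerivAt_linearFlow (mulVecCLM A) x t₀ t).hasDerivWithinAt

theorem IsSolution.eq_zero (hφ : IsSolution (constantField A) t₀ φ) (h₀ : φ t₀ = 0) {t : ℝ}
    (ht : t₀ ≤ t) : φ t = 0 := by
  refine eq_zero_of_abs_deriv_le_mul_abs_self_of_eq_zero_right (a := t₀) (b := t)
    (K := ‖mulVecCLM A‖) (f' := fun s => A.mulVec (φ s)) ?_ ?_ h₀ ?_ t ⟨ht, le_rfl⟩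
  · exact fun s hs => ((hφ s hs.1).continuousWithinAt).mono Set.Icc_subset_Ici_self
  · exact fun s hs => (hφ s hs.1).mono (Set.Ici_subset_Ici.2 hs.1)
  · exact fun s _ => (mulVecCLM A).le_opNorm (φ s)

theorem IsSolution.eq_linearFlow (hφ : IsSolution (constantField A) t₀ φ) {t : ℝ} (ht : t₀ ≤ t) :
    φ t = linearFlow (mulVecCLM A) (t - t₀) (φ t₀) :=
  sub_eq_zero.1 <|
    (hφ.sub (isSolution_linearFlow A t₀ (φ t₀))).eq_zero (by simp [linearFlow_zero]) ht

/-- By scaling and by the uniform boundedness principle for the operators `exp ((t - t₀) A)`. -/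
theorem isStableSystem_iff : IsStableSystem A t₀ ↔
    ∀ φ, IsSolution (constantField A) t₀ φ → ∃ M, ∀ t ≥ t₀, ‖φ t‖ ≤ M := by
  constructor
  · intro h φ hφ
    obtain ⟨δ, hδ, hst⟩ := h _ isSolution_zero 1 one_pos
    have hpos : 0 < vecNorm (φ t₀) + 1 := by linarith [vecNorm_nonneg (φ t₀)]
    set c := δ / (vecNorm (φ t₀) + 1) with hc
    have hc0 : 0 < c := div_pos hδ hpos
    have hinit : vecNorm (c • φ t₀ - 0) < δ := by
      rw [sub_zero, vecNorm_smul, abs_of_pos hc0, hc, div_mul_eq_mul_div, div_lt_iff₀ hpos]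
      nlinarith
    refine ⟨c⁻¹, fun t ht => ?_⟩
    have h1 := (hst _ hinit).2 _ (hφ.const_smul c) rfl t ht
    rw [sub_zero, vecNorm_smul, abs_of_pos hc0] at h1
    have h2 := norm_le_vecNorm (φ t)
    rw [← one_div, le_div_iff₀' hc0]
    nlinarith
  · intro h φ hφ ε hε
    obtain ⟨C, hC⟩ := banach_steinhaus
      (g := fun s : Set.Ici t₀ => linearFlow (mulVecCLM A) ((s : ℝ) - t₀)) fun x => by
        obtain ⟨M, hM⟩ := h _ (isSolution_linearFlow A t₀ x)
        exact ⟨M, fun s => hM s s.2⟩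
    have hC0 : 0 ≤ C := (norm_nonneg _).trans (hC ⟨t₀, Set.self_mem_Ici⟩)
    have hK : 0 < n * C + 1 := by positivity
    refine ⟨ε / (n * C + 1), by positivity, fun x hx =>
      ⟨⟨_, isSolution_linearFlow A t₀ x, by simp [linearFlow_zero]⟩, fun ψ hψ hψx t ht => ?_⟩⟩
    have h1 := (hψ.sub hφ).eq_linearFlow ht
    rw [hψx] at h1
    have h2 : ‖ψ t - φ t‖ ≤ C * vecNorm (x - φ t₀) := by
      rw [h1]
      refine ((linearFlow (mulVecCLM A) (t - t₀)).le_opNorm _).trans ?_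
      exact mul_le_mul (hC ⟨t, ht⟩) (norm_le_vecNorm _) (norm_nonneg _) hC0
    rw [lt_div_iff₀ hK] at hx
    have h3 := vecNorm_nonneg (x - φ t₀)
    calc vecNorm (ψ t - φ t) ≤ n * ‖ψ t - φ t‖ := vecNorm_le _
      _ ≤ n * (C * vecNorm (x - φ t₀)) := by gcongr
      _ ≤ vecNorm (x - φ t₀) * (n * C + 1) := by nlinarith
      _ < ε := hx

theorem isAsymptoticallyStableSystem_iff : IsAsymptoticallyStableSystem A t₀ ↔
    ∀ φ, IsSolution (constantField A) t₀ φ → Filter.Tendsto φ Filter.atTop (nhds 0) := by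
  constructor
  · intro h φ hφ
    obtain ⟨δ, hδ, hst⟩ := h _ isSolution_zero
    have hpos : 0 < vecNorm (φ t₀) + 1 := by linarith [vecNorm_nonneg (φ t₀)]
    set c := δ / (vecNorm (φ t₀) + 1) with hc
    have hc0 : 0 < c := div_pos hδ hpos
    have hinit : vecNorm (c • φ t₀ - 0) < δ := by
      rw [sub_zero, vecNorm_smul, abs_of_pos hc0, hc, div_mul_eq_mul_div, div_lt_iff₀ hpos]
      nlinarith
    have h1 := (hst _ hinit).2 _ (hφ.const_smul c) rfl
    have h2 := (tendsto_vecNorm_iff.1 h1).const_smul c⁻¹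
    simpa [hc0.ne'] using h2
  · intro h φ hφ
    refine ⟨1, one_pos, fun x _ =>
      ⟨⟨_, isSolution_linearFlow A t₀ x, by simp [linearFlow_zero]⟩, fun ψ hψ _ => ?_⟩⟩
    exact tendsto_vecNorm_iff.2 (h _ (hψ.sub hφ))

end LinearSystems

/-! ### Growth of solutions in Jordan coordinates -/

section ScalarEquation

/-- The complex exponential `e^{z s}` as a quaternion. -/
noncomputable def quatExp (z : ℂ) (s : ℝ) : ℍ[ℝ] := coeComplex (Complex.exp (z * s))

theorem norm_coeComplex (z : ℂ) : ‖coeComplex z‖ = ‖z‖ := by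
  have h : ‖coeComplex z‖ * ‖coeComplex z‖ = ‖z‖ * ‖z‖ := by
    rw [← Quaternion.normSq_eq_norm_mul_self, ← pow_two ‖z‖, ← Complex.normSq_eq_norm_sq,
      Quaternion.normSq_def', Complex.normSq_apply]
    simp
    ring
  exact (mul_self_inj (norm_nonneg _) (norm_nonneg _)).1 h

theorem norm_quatExp (z : ℂ) (s : ℝ) : ‖quatExp z s‖ = Real.exp (z.re * s) := by
  rw [quatExp, norm_coeComplex, Complex.norm_exp]
  simp

theorem quatExp_zero (z : ℂ) : quatExp z 0 = 1 := by
  simp [quatExp]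

theorem coeComplex_mul_comm (z w : ℂ) :
    coeComplex z * coeComplex w = coeComplex w * coeComplex z := by
  rw [← coeComplex_mul, mul_comm, coeComplex_mul]

theorem hasDerivAt_quatExp (z : ℂ) (t₀ t : ℝ) :
    HasDerivAt (fun t => quatExp z (t - t₀)) (coeComplex z * quatExp z (t - t₀)) t := by
  have h1 : HasDerivAt (fun t : ℝ => Complex.exp (z * ((t - t₀ : ℝ) : ℂ)))
      (z * Complex.exp (z * ((t - t₀ : ℝ) : ℂ))) t := by
    have h2 : HasDerivAt (fun t : ℝ => z * ((t - t₀ : ℝ) : ℂ)) z t := by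
      simpa using (((hasDerivAt_id t).sub_const t₀).ofReal_comp).const_mul z
    simpa [mul_comm] using h2.cexp
  let L : ℂ →L[ℝ] ℍ[ℝ] := LinearMap.toContinuousLinearMap Quaternion.ofComplex.toLinearMap
  have h3 := L.hasFDerivAt.comp_hasDerivAt t h1
  rw [quatExp, ← coeComplex_mul]
  exact h3

/-- Variation of constants for `y' = z y + g`: the function `e^{-z (t - t₀)} y` has derivative
`e^{-z (t - t₀)} g`, whose norm is at most `B'`. -/
theorem norm_le_of_scalar_equation {z : ℂ} {t₀ : ℝ} {y g : ℝ → ℍ[ℝ]} {B B' : ℝ → ℝ}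
    (hy : ∀ t ∈ Set.Ici t₀, HasDerivWithinAt y (coeComplex z * y t + g t) (Set.Ici t₀) t)
    (hB : ∀ t, HasDerivAt B (B' t) t) (h₀ : ‖y t₀‖ ≤ B t₀)
    (hg : ∀ t ≥ t₀, ‖g t‖ ≤ Real.exp (z.re * (t - t₀)) * B' t) {t : ℝ} (ht : t₀ ≤ t) :
    ‖y t‖ ≤ Real.exp (z.re * (t - t₀)) * B t := by
  have hder : ∀ s ∈ Set.Ici t₀, HasDerivWithinAt (fun s => quatExp (-z) (s - t₀) * y s)
      (quatExp (-z) (s - t₀) * g s) (Set.Ici t₀) s := by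
    intro s hs
    have h1 := (hasDerivAt_quatExp (-z) t₀ s).hasDerivWithinAt.mul (hy s hs)
    refine h1.congr_deriv ?_
    have h2 : coeComplex (-z) = -coeComplex z := map_neg Quaternion.ofComplex z
    have h3 : coeComplex z * quatExp (-z) (s - t₀) = quatExp (-z) (s - t₀) * coeComplex z :=
      coeComplex_mul_comm _ _
    rw [h2, neg_mul, h3]
    noncomm_ring
  have hle := image_norm_le_of_norm_deriv_right_le_deriv_boundary (a := t₀) (b := t) (B := B)
    (B' := B') (f := fun s => quatExp (-z) (s - t₀) * y s)
    (f' := fun s => quatExp (-z) (s - t₀) * g s)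
    (fun s hs => (hder s hs.1).continuousWithinAt.mono Set.Icc_subset_Ici_self)
    (fun s hs => (hder s hs.1).mono (Set.Ici_subset_Ici.2 hs.1))
    (by simpa [quatExp_zero] using h₀) hB (fun s hs => by
      rw [norm_mul, norm_quatExp]
      have := mul_le_mul_of_nonneg_left (hg s hs.1) (Real.exp_nonneg ((-z).re * (s - t₀)))
      rwa [← mul_assoc, ← Real.exp_add, ← add_mul, Complex.neg_re, neg_add_cancel, zero_mul,
        Real.exp_zero, one_mul] at this) ⟨ht, le_rfl⟩
  rw [norm_mul, norm_quatExp] at hle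
  have := mul_le_mul_of_nonneg_left hle (Real.exp_nonneg (z.re * (t - t₀)))
  rwa [← mul_assoc, ← Real.exp_add, Complex.neg_re, neg_mul, add_neg_cancel, Real.exp_zero,
    one_mul] at this

/-- A forcing term that decays like `e^{-σ t}`, more slowly than the homogeneous equation,
passes its rate of decay on to the solutions. -/
theorem exists_decay_of_scalar_equation {z : ℂ} {t₀ σ C : ℝ} {y g : ℝ → ℍ[ℝ]} (hσ : z.re < -σ)
    (hC : 0 ≤ C)
    (hy : ∀ t ∈ Set.Ici t₀, HasDerivWithinAt y (coeComplex z * y t + g t) (Set.Ici t₀) t)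
    (hg : ∀ t ≥ t₀, ‖g t‖ ≤ C * Real.exp (-σ * (t - t₀))) :
    ∃ C' ≥ 0, ∀ t ≥ t₀, ‖y t‖ ≤ C' * Real.exp (-σ * (t - t₀)) := by
  set a := -σ - z.re with ha
  have ha0 : 0 < a := by linarith
  have hB : ∀ t, HasDerivAt (fun t => ‖y t₀‖ + C / a * Real.exp (a * (t - t₀)))
      (C * Real.exp (a * (t - t₀))) t := by
    intro t
    have h1 : HasDerivAt (fun t : ℝ => a * (t - t₀)) a t := by
      simpa using ((hasDerivAt_id t).sub_const t₀).const_mul a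
    refine ((h1.exp.const_mul (C / a)).const_add ‖y t₀‖).congr_deriv ?_
    field_simp
  refine ⟨‖y t₀‖ + C / a, by positivity, fun t ht => ?_⟩
  refine (norm_le_of_scalar_equation hy hB ?_ ?_ ht).trans ?_
  · have : 0 ≤ C / a * Real.exp (a * (t₀ - t₀)) := by positivity
    linarith
  · intro s hs
    refine (hg s hs).trans_eq ?_
    rw [mul_left_comm, ← Real.exp_add]
    congr 2
    rw [ha]
    ring
  · have h1 : Real.exp (z.re * (t - t₀)) ≤ Real.exp (-σ * (t - t₀)) :=
      Real.exp_le_exp.2 (mul_le_mul_of_nonneg_right hσ.le (by linarith))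
    have h2 : Real.exp (z.re * (t - t₀)) * Real.exp (a * (t - t₀)) =
        Real.exp (-σ * (t - t₀)) := by
      rw [← Real.exp_add]
      congr 1
      rw [ha]
      ring
    rw [mul_add, mul_left_comm, h2, add_mul, mul_comm _ ‖y t₀‖]
    gcongr

end ScalarEquation

section Growth

variable {n : ℕ} {J : Matrix (Fin n) (Fin n) ℂ} {t₀ : ℝ} {y : ℝ → Fin n → ℍ[ℝ]}

theorem IsJordanMatrix.hasDerivWithinAt_apply (hJ : IsJordanMatrix J)
    (hy : IsSolution (constantField (J.map coeComplex)) t₀ y) {i j : Fin n} (hij : (j : ℕ) = i + 1)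
    {t : ℝ} (ht : t ∈ Set.Ici t₀) : HasDerivWithinAt (fun t => y t i)
      (coeComplex (J i i) * y t i + coeComplex (J i j) * y t j) (Set.Ici t₀) t := by
  have := hasDerivWithinAt_pi.1 (hy t ht) i
  rwa [constantField, mulVec_apply_of_bidiagonal hJ.map_bidiagonal _ hij] at this

theorem IsJordanMatrix.hasDerivWithinAt_apply_last (hJ : IsJordanMatrix J)
    (hy : IsSolution (constantField (J.map coeComplex)) t₀ y) {i : Fin n}
    (hi : ∀ j : Fin n, (j : ℕ) ≠ i + 1) {t : ℝ} (ht : t ∈ Set.Ici t₀) :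
    HasDerivWithinAt (fun t => y t i) (coeComplex (J i i) * y t i + 0) (Set.Ici t₀) t := by
  have := hasDerivWithinAt_pi.1 (hy t ht) i
  rw [constantField, mulVec_apply_of_bidiagonal_last hJ.map_bidiagonal _ hi] at this
  rwa [add_zero]

/-- In a Jordan block whose eigenvalue has real part less than `-σ`, the coordinates decay like
`e^{-σ t}`, by induction from the last coordinate of the block upwards. -/
theorem IsJordanMatrix.exists_decay (hJ : IsJordanMatrix J)
    (hy : IsSolution (constantField (J.map coeComplex)) t₀ y) (σ : ℝ) (i : Fin n)
    (hi : (J i i).re < -σ) :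
    ∃ C ≥ 0, ∀ t ≥ t₀, ‖y t i‖ ≤ C * Real.exp (-σ * (t - t₀)) := by
  induction hk : n - (i : ℕ) using Nat.strong_induction_on generalizing i with
  | _ k ih =>
  by_cases h : ∃ j : Fin n, (j : ℕ) = i + 1
  · obtain ⟨j, hj⟩ := h
    rcases hJ.2 i j hj with h0 | ⟨h1, h0⟩
    · refine exists_decay_of_scalar_equation hi le_rfl
        (fun t ht => hJ.hasDerivWithinAt_apply hy hj ht) fun t _ => ?_
      simp [h0]
    · obtain ⟨C, hC, hCj⟩ := ih (n - j) (by omega) j (h0 ▸ hi) rfl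
      refine exists_decay_of_scalar_equation hi hC
        (fun t ht => hJ.hasDerivWithinAt_apply hy hj ht) fun t ht => ?_
      rw [h1, coeComplex_one, one_mul]
      exact hCj t ht
  · push Not at h
    refine exists_decay_of_scalar_equation hi le_rfl
      (fun t ht => hJ.hasDerivWithinAt_apply_last hy h ht) fun t _ => ?_
    simp

theorem IsJordanMatrix.tendsto_zero (hJ : IsJordanMatrix J)
    (hy : IsSolution (constantField (J.map coeComplex)) t₀ y) {i : Fin n} (hi : (J i i).re < 0) :
    Filter.Tendsto (fun t => y t i) Filter.atTop (nhds 0) := by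
  -- any rate strictly between `0` and `-Re Jᵢᵢ` will do
  obtain ⟨C, -, hC⟩ := hJ.exists_decay hy (-(J i i).re / 2) i (by linarith)
  refine squeeze_zero_norm' (a := fun t => C * Real.exp (-(-(J i i).re / 2) * (t - t₀)))
    ((Filter.eventually_ge_atTop t₀).mono fun t ht => hC t ht) ?_
  rw [← mul_zero C]
  refine (Real.tendsto_exp_atBot.comp ?_).const_mul C
  exact (Filter.tendsto_atTop_add_const_right _ (-t₀) Filter.tendsto_id).const_mul_atTop_of_neg
    (by linarith)

theorem IsJordanMatrix.exists_bound (hJ : IsJordanMatrix J)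
    (hy : IsSolution (constantField (J.map coeComplex)) t₀ y) {i : Fin n} (hi : (J i i).re ≤ 0)
    (hblock : (J i i).re = 0 → ∀ j : Fin n, (j : ℕ) = i + 1 → J i j = 0) :
    ∃ M ≥ 0, ∀ t ≥ t₀, ‖y t i‖ ≤ M := by
  rcases hi.lt_or_eq with hneg | hzero
  · obtain ⟨C, hC0, hC⟩ := hJ.exists_decay hy 0 i (by simpa using hneg)
    exact ⟨C, hC0, fun t ht => by simpa using hC t ht⟩
  · refine ⟨‖y t₀ i‖, norm_nonneg _, fun t ht => ?_⟩
    have hder : ∀ t ∈ Set.Ici t₀, HasDerivWithinAt (fun t => y t i)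
        (coeComplex (J i i) * y t i + 0) (Set.Ici t₀) t := by
      intro t ht
      by_cases h : ∃ j : Fin n, (j : ℕ) = i + 1
      · obtain ⟨j, hj⟩ := h
        simpa [hblock hzero j hj] using hJ.hasDerivWithinAt_apply hy hj ht
      · push Not at h
        exact hJ.hasDerivWithinAt_apply_last hy h ht
    have := norm_le_of_scalar_equation (B := fun _ => ‖y t₀ i‖) (B' := fun _ => 0) hder
      (fun t => hasDerivAt_const t _) le_rfl (fun t _ => by simp) ht
    simpa [hzero] using this

end Growth

section ExplicitSolutions

variable {n : ℕ} {A : Matrix (Fin n) (Fin n) ℍ[ℝ]} {t₀ : ℝ} {z : ℂ} {u w : Fin n → ℍ[ℝ]}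

/-- A Jordan chain `w, u` of length two (or an eigenvector `u`, when `w = 0`) gives the solution
`(u + (t - t₀) w) e^{z (t - t₀)}`. -/
theorem isSolution_chain (hu : A.mulVec u = fun i => u i * coeComplex z + w i)
    (hw : A.mulVec w = fun i => w i * coeComplex z) :
    IsSolution (constantField A) t₀
      fun t i => (u i + (t - t₀) • w i) * quatExp z (t - t₀) := by
  intro t _
  refine HasDerivAt.hasDerivWithinAt (hasDerivAt_pi.2 fun i => ?_)
  have h1 : HasDerivAt (fun t : ℝ => u i + (t - t₀) • w i) (w i) t := by
    simpa using (((hasDerivAt_id t).sub_const t₀).smul_const (w i)).const_add (u i)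
  refine (h1.mul (hasDerivAt_quatExp z t₀ t)).congr_deriv ?_
  have h2 : (fun i => u i + (t - t₀) • w i) = u + (t - t₀) • w := rfl
  have h3 : (A.mulVec fun i => (u i + (t - t₀) • w i) * quatExp z (t - t₀)) i =
      (u i * coeComplex z + w i + (t - t₀) • (w i * coeComplex z)) * quatExp z (t - t₀) := by
    rw [mulVec_mul_right, h2, Matrix.mulVec_add, Matrix.mulVec_smul, hu, hw]
    rfl
  rw [constantField, h3, ← smul_mul_assoc, ← mul_assoc, ← add_mul]
  congr 1
  rw [add_mul]
  abel

theorem norm_eigenvector_solution (i : Fin n) (t : ℝ) :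
    ‖(u i + (t - t₀) • (0 : Fin n → ℍ[ℝ]) i) * quatExp z (t - t₀)‖ =
      ‖u i‖ * Real.exp (z.re * (t - t₀)) := by
  rw [Pi.zero_apply, smul_zero, add_zero, norm_mul, norm_quatExp]

theorem re_nonpos_of_isStableSystem (h : IsStableSystem A t₀)
    (hz : IsRightEigenvalue A (coeComplex z)) : z.re ≤ 0 := by
  obtain ⟨η, hη, hAη⟩ := hz
  obtain ⟨i, hi⟩ := Function.ne_iff.1 hη
  obtain ⟨M, hM⟩ := isStableSystem_iff.1 h _ (isSolution_chain (t₀ := t₀) (u := η) (w := 0)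
    (by simpa using hAη) (by ext1; simp))
  by_contra! hpos
  have h1 : Filter.Tendsto (fun t : ℝ => ‖η i‖ * Real.exp (z.re * (t - t₀))) Filter.atTop
      Filter.atTop := by
    refine (Real.tendsto_exp_atTop.comp ?_).const_mul_atTop (norm_pos_iff.2 hi)
    exact (Filter.tendsto_atTop_add_const_right _ (-t₀) Filter.tendsto_id).const_mul_atTop hpos
  obtain ⟨t, ht, ht0⟩ := ((h1.eventually_gt_atTop M).and (Filter.eventually_ge_atTop t₀)).exists
  have h2 := (norm_le_pi_norm _ i).trans (hM t ht0)
  rw [norm_eigenvector_solution] at h2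
  linarith

theorem re_neg_of_isAsymptoticallyStableSystem (h : IsAsymptoticallyStableSystem A t₀)
    (hz : IsRightEigenvalue A (coeComplex z)) : z.re < 0 := by
  obtain ⟨η, hη, hAη⟩ := hz
  obtain ⟨i, hi⟩ := Function.ne_iff.1 hη
  have h1 := isAsymptoticallyStableSystem_iff.1 h _ (isSolution_chain (t₀ := t₀) (u := η) (w := 0)
    (by simpa using hAη) (by ext1; simp))
  have h2 := (tendsto_pi_nhds.1 h1 i).norm.congr (norm_eigenvector_solution i)
  rw [Pi.zero_apply, norm_zero] at h2
  by_contra! hpos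
  obtain ⟨t, ht, ht0⟩ := ((h2.eventually_lt_const (norm_pos_iff.2 hi)).and
    (Filter.eventually_ge_atTop t₀)).exists
  have h3 : 1 ≤ Real.exp (z.re * (t - t₀)) :=
    Real.one_le_exp (mul_nonneg hpos (sub_nonneg.2 ht0))
  have h4 := norm_nonneg (η i)
  nlinarith

/-- For a purely imaginary `z`, the solution attached to a Jordan chain of length two grows
linearly. -/
theorem eq_zero_of_isStableSystem_of_chain (h : IsStableSystem A t₀) (hz : z.re = 0)
    (hu : A.mulVec u = fun i => u i * coeComplex z + w i)
    (hw : A.mulVec w = fun i => w i * coeComplex z) : w = 0 := by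
  by_contra hne
  obtain ⟨i, hi⟩ := Function.ne_iff.1 hne
  obtain ⟨M, hM⟩ := isStableSystem_iff.1 h _ (isSolution_chain (t₀ := t₀) hu hw)
  have h1 : Filter.Tendsto (fun t : ℝ => (t - t₀) * ‖w i‖) Filter.atTop Filter.atTop :=
    (Filter.tendsto_atTop_add_const_right _ (-t₀) Filter.tendsto_id).atTop_mul_const
      (norm_pos_iff.2 hi)
  obtain ⟨t, ht, ht0⟩ := ((h1.eventually_gt_atTop (M + ‖u i‖)).and
    (Filter.eventually_ge_atTop t₀)).exists
  have h2 := (norm_le_pi_norm _ i).trans (hM t ht0)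
  rw [norm_mul, norm_quatExp, hz, zero_mul, Real.exp_zero, mul_one] at h2
  have h3 := norm_sub_norm_le ((t - t₀) • w i) (-u i)
  rw [sub_neg_eq_add, add_comm _ (u i), norm_neg, norm_smul, Real.norm_eq_abs,
    abs_of_nonneg (sub_nonneg.2 ht0)] at h3
  linarith

end ExplicitSolutions

section Stability

variable {n : ℕ} {J : Matrix (Fin n) (Fin n) ℂ} {A : Matrix (Fin n) (Fin n) ℍ[ℝ]} {t₀ : ℝ}

theorem IsJordanMatrix.mulVec_single (hJ : IsJordanMatrix J) {i j : Fin n}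
    (hij : (j : ℕ) = i + 1) (q : ℍ[ℝ]) : (J.map coeComplex).mulVec (Pi.single j q) =
      Pi.single j (coeComplex (J j j) * q) + Pi.single i (coeComplex (J i j) * q) := by
  have hne : i ≠ j := fun h => by rw [h] at hij; omega
  funext k
  rw [Matrix.mulVec_single]
  by_cases hkj : k = j
  · subst hkj
    simp [hne.symm]
  · by_cases hki : k = i
    · subst hki
      simp [hne]
    · simp [hkj, hki, hJ.1 k j (fun h => hkj (Fin.ext h.symm))
        (fun h => hki (Fin.ext (by omega)))]

/-- If the system is stable, then the Jordan blocks for the purely imaginary eigenvalues have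
size `1`: otherwise the first two vectors of such a block are a Jordan chain of length two. -/
theorem superdiagonal_eq_zero_of_isStableSystem (hJ : IsJordanFormOf J A)
    (h : IsStableSystem A t₀) (i j : Fin n) (hij : (j : ℕ) = i + 1) (hz : (J i i).re = 0) :
    J i j = 0 := by
  obtain ⟨hJm, -, P, hP⟩ := hJ
  have hAP : A * P = P * J.map coeComplex := by
    rw [← hP, ← Matrix.mul_assoc, ← Matrix.mul_assoc, Units.mul_inv, Matrix.one_mul]
  induction hk : (i : ℕ) using Nat.strong_induction_on generalizing i j with
  | _ k ih =>
  by_contra hne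
  obtain ⟨h1, h2⟩ := (hJm.2 i j hij).resolve_left hne
  -- `e_i` is an eigenvector: the entry above it vanishes by induction
  have hi : (J.map coeComplex).mulVec (Pi.single i 1) = Pi.single i (coeComplex (J i i)) := by
    by_cases hpred : ∃ l : Fin n, (i : ℕ) = l + 1
    · obtain ⟨l, hl⟩ := hpred
      have hli : J l i = 0 := by
        rcases hJm.2 l i hl with h0 | ⟨-, h0⟩
        · exact h0
        · exact ih l (by omega) l i hl (h0 ▸ hz) rfl
      rw [hJm.mulVec_single hl, hli]
      simp
    · push Not at hpred
      funext l
      rw [Matrix.mulVec_single]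
      by_cases hli : l = i
      · subst hli
        simp
      · simp [hli, hJm.1 l i (fun h => hli (Fin.ext h.symm)) (hpred l)]
  have hj : (J.map coeComplex).mulVec (Pi.single j 1) =
      Pi.single j (coeComplex (J i i)) + Pi.single i 1 := by
    rw [hJm.mulVec_single hij, h1, ← h2, mul_one, coeComplex_one, mul_one]
  have hsingle : ∀ k : Fin n, (Pi.single k (coeComplex (J i i)) : Fin n → ℍ[ℝ]) =
      fun l => (Pi.single k 1 : Fin n → ℍ[ℝ]) l * coeComplex (J i i) := by
    intro k
    funext l
    by_cases hl : l = k
    · subst hl; simp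
    · simp [hl]
  have hw := eq_zero_of_isStableSystem_of_chain (z := J i i)
    (u := (P : Matrix (Fin n) (Fin n) ℍ[ℝ]).mulVec (Pi.single j 1))
    (w := (P : Matrix (Fin n) (Fin n) ℍ[ℝ]).mulVec (Pi.single i 1)) h hz
    (by
      rw [Matrix.mulVec_mulVec, hAP, ← Matrix.mulVec_mulVec, hj, Matrix.mulVec_add, hsingle,
        mulVec_mul_right]
      rfl)
    (by rw [Matrix.mulVec_mulVec, hAP, ← Matrix.mulVec_mulVec, hi, hsingle, mulVec_mul_right])
  have h3 := congrArg (((P⁻¹ : (Matrix (Fin n) (Fin n) ℍ[ℝ])ˣ) :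
    Matrix (Fin n) (Fin n) ℍ[ℝ]).mulVec) hw
  rw [Matrix.mulVec_mulVec, Units.inv_mul, Matrix.one_mulVec, Matrix.mulVec_zero] at h3
  simpa using congrFun h3 i

/-- In Jordan coordinates `y = P⁻¹ φ`, a solution `φ = P y` of the system solves `y' = J y`. -/
theorem IsJordanFormOf.exists_coordinates (hJ : IsJordanFormOf J A) {φ : ℝ → Fin n → ℍ[ℝ]}
    (hφ : IsSolution (constantField A) t₀ φ) :
    ∃ (P : Matrix (Fin n) (Fin n) ℍ[ℝ]) (y : ℝ → Fin n → ℍ[ℝ]),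
      IsSolution (constantField (J.map coeComplex)) t₀ y ∧ φ = fun t => mulVecCLM P (y t) := by
  obtain ⟨-, -, P, hP⟩ := hJ
  refine ⟨P, _, hφ.mulVec (Q := ((P⁻¹ : (Matrix (Fin n) (Fin n) ℍ[ℝ])ˣ) :
    Matrix (Fin n) (Fin n) ℍ[ℝ])) ?_, ?_⟩
  · rw [← hP, Matrix.mul_assoc, Units.mul_inv, Matrix.mul_one]
  · funext t
    rw [mulVecCLM_apply, Matrix.mulVec_mulVec, Units.mul_inv, Matrix.one_mulVec]

theorem isStableSystem_iff_of_isJordanFormOf (hJ : IsJordanFormOf J A) :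
    IsStableSystem A t₀ ↔
      (∀ z : ℂ, IsStandardEigenvalue A z → z.re ≤ 0) ∧
      (∀ z : ℂ, IsStandardEigenvalue A z → z.re = 0 →
        algebraicMultiplicity J z = geometricMultiplicity J z) := by
  constructor
  · refine fun h => ⟨fun z hz => re_nonpos_of_isStableSystem h hz.2, fun z _ hz0 => ?_⟩
    rw [hJ.1.algebraicMultiplicity_eq_iff]
    rintro i j hij rfl
    exact superdiagonal_eq_zero_of_isStableSystem hJ h i j hij hz0
  · rintro ⟨hre, hmult⟩
    have heig : ∀ i, IsStandardEigenvalue A (J i i) :=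
      fun i => (isStandardEigenvalue_iff hJ _).2 ⟨i, rfl⟩
    refine isStableSystem_iff.2 fun φ hφ => ?_
    obtain ⟨P, y, hy, rfl⟩ := hJ.exists_coordinates hφ
    choose M hM0 hM using fun i => hJ.1.exists_bound hy (hre _ (heig i)) fun h0 j hj =>
      (hJ.1.algebraicMultiplicity_eq_iff _).1 (hmult _ (heig i) h0) i j hj rfl
    refine ⟨‖mulVecCLM P‖ * ∑ i, M i, fun t ht => ?_⟩
    refine ((mulVecCLM P).le_opNorm _).trans (mul_le_mul_of_nonneg_left ?_ (norm_nonneg _))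
    exact (pi_norm_le_iff_of_nonneg (Finset.sum_nonneg fun i _ => hM0 i)).2 fun i =>
      (hM i t ht).trans (Finset.single_le_sum (fun k _ => hM0 k) (Finset.mem_univ i))

theorem isAsymptoticallyStableSystem_iff_re_neg :
    IsAsymptoticallyStableSystem A t₀ ↔ ∀ z : ℂ, IsStandardEigenvalue A z → z.re < 0 := by
  refine ⟨fun h z hz => re_neg_of_isAsymptoticallyStableSystem h hz.2, fun hre => ?_⟩
  obtain ⟨J, hJ⟩ := exists_isJordanFormOf A
  refine isAsymptoticallyStableSystem_iff.2 fun φ hφ => ?_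
  obtain ⟨P, y, hy, rfl⟩ := hJ.exists_coordinates hφ
  have hy0 : Filter.Tendsto y Filter.atTop (nhds 0) := tendsto_pi_nhds.2 fun i =>
    hJ.1.tendsto_zero hy (hre _ ((isStandardEigenvalue_iff hJ _).2 ⟨i, rfl⟩))
  simpa [Function.comp_def] using ((mulVecCLM P).continuous.tendsto 0).comp hy0

end Stability

end QuaternionODE

theorem mainTheorem2 (n : ℕ) (A : Matrix (Fin n) (Fin n) (Quaternion ℝ)) (t₀ : ℝ) :
    (∃ J : Matrix (Fin n) (Fin n) ℂ, QuaternionODE.IsJordanFormOf J A) ∧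
    (∀ J : Matrix (Fin n) (Fin n) ℂ, QuaternionODE.IsJordanFormOf J A →
      (QuaternionODE.IsStableSystem A t₀ ↔
        (∀ z : ℂ, QuaternionODE.IsStandardEigenvalue A z → z.re ≤ 0) ∧
        (∀ z : ℂ, QuaternionODE.IsStandardEigenvalue A z → z.re = 0 →
          QuaternionODE.algebraicMultiplicity J z = QuaternionODE.geometricMultiplicity J z))) ∧
    (QuaternionODE.IsAsymptoticallyStableSystem A t₀ ↔
      ∀ z : ℂ, QuaternionODE.IsStandardEigenvalue A z → z.re < 0) :=
  ⟨QuaternionODE.exists_isJordanFormOf A,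
    fun _ hJ => QuaternionODE.isStableSystem_iff_of_isJordanFormOf hJ,
    QuaternionODE.isAsymptoticallyStableSystem_iff_re_neg⟩
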